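/- **Setting.** Fix integers $s,T\ge 1$ and $d\ge 4s$, reals $L_f,L>0$ and $R\ge 0$, a compact convex set $\mathcal X\subset\mathbb R^d$ with $\|x\|\le R$ for all $x\in\mathcal X$, and an initial point $x_1\in\mathcal X$. Norms are Euclidean. Let $\mathcal F$ be the set of functions $f:\mathbb R^d\to\mathbb R$ that are convex, $L_f$-Lipschitz, differentiable with $L$-Lipschitz gradient, and whose gradient $\nabla f(x)$ has at most $s$ nonzero entries for every $x\in\mathcal X$. Put $D=\sup_{x,y\in\mathcal X}\frac12\|x-y\|^2$. **CoSaMP.** Given a matrix $M$, data $y$ and $s$, CoSaMP with $n$ iterations returns $z^n$, where $z^0=0$ and $z^{k+1}$ is obtained from $z^k$ as follows: let $U$ be the union of the support of $z^k$ and the indices of $2s$ entries of largest modulus of $M^{\mathsf T}(y-Mz^k)$; let $u$ minimise $\|y-Mu\|$ over vectors supported in $U$; let $z^{k+1}$ keep $s$ entries of largest modulus of $u$ and set the others to $0$. Ties and non-unique minimisers may be resolved by an arbitrary fixed rule. **Algorithms.** In round $t=1,\dots,T$, with a fresh $m\times d$ matrix $A_t$ with rows $a_1,\dots,a_m$, the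 algorithm samples $f_t$ at $x_t$ and at the $m$ points $x_t+\frac{\delta}{\|a_i\|^2}a_i$, forms $y_i=\big(f_t(x_t+\frac{\delta}{\|a_i\|^2}a_i)-f_t(x_t)\big)\frac{\|a_i\|^2}{\delta}$, lets $\hat g_t$ be the output of CoSaMP with $n$ iterations on $(A_t/\sqrt m,\ y/\sqrt m,\ s)$, replaces $\hat g_t$ by $0$ if $\|\hat g_t\|>L_f+\frac{7.21}{2}L\delta$, and lets $x_{t+1}$ be the point of $\mathcal X$ nearest to $x_t-\eta\hat g_t$. The entries of $A_1,\dots,A_T$ are independent; they are Rademacher ($\pm1$ with probability $\frac12$ each) for CONGO-Z and standard normal for CONGO-E. The regret is $$R(T)=\sup_{f_1,\dots,f_T\in\mathcal F}\Big(\sum_{t=1}^T f_t(x_t)-\min_{x\in\mathcal X}\sum_{t=1}^T f_t(x)\Big),$$ a nonnegative function of $A_1,\dots,A_T$, and $\mathbb E$ denotes its expectation (the outer expectation, if $R(T)$ should fail to be measurable). **Theorem.** For each of CONGO-Z and CONGO-E there are absolute constants $C,\kappa>0$ and a function $N(L_f,T)$ such that the following holds in the above setting. If $$\eta=\frac1{L_f\sqrt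 T},\qquad \delta=\frac{2}{7.2\,LT},\qquad m=\Big\lceil C\Big(4s\log\frac{ed}{4s}+\log(2T)\Big)\Big\rceil,$$ and CoSaMP is run with any number $n\ge N(L_f,T)$ of iterations, then the algorithm takes exactly $m+1$ function samples per round, and $$\mathbb E[R(T)]\ \le\ \kappa\,\max\{1,1/R\}\,\Big(D+\frac R2+\frac{4R}{L_f}\Big)L_f\sqrt T$$ (for $R=0$ the right-hand side is read as $0$). In particular, for fixed $R$ the expected regret is $O\big((D+\frac R2+\frac{4R}{L_f})L_f\sqrt T\big)$ with an implied constant that depends only on $R$, and that is absolute for $R\ge1$. -/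

import Mathlib

open MeasureTheory ProbabilityTheory

/-- The Euclidean space `ℝⁿ`. -/
abbrev Vec (n : ℕ) : Type := EuclideanSpace ℝ (Fin n)

/-! ### The online problem -/

/-- The support of a vector. -/
noncomputable def vecSupport {d : ℕ} (x : Vec d) : Finset (Fin d) := Finset.univ.filter fun j => x j ≠ 0

/-- The admissible functions: convex, `Lf`-Lipschitz and `L`-smooth on `ℝᵈ`, with an `s`-sparse
gradient at every point of the constraint set `K`. -/
structure IsAdmissible {d : ℕ} (K : Set (Vec d)) (s : ℕ) (Lf L : ℝ) (f : Vec d → ℝ) : Prop where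
  convex : ConvexOn ℝ Set.univ f
  lipschitz : ∀ x y, |f x - f y| ≤ Lf * ‖x - y‖
  differentiable : Differentiable ℝ f
  smooth : ∀ x y, ‖gradient f x - gradient f y‖ ≤ L * ‖x - y‖
  sparse : ∀ x ∈ K, (vecSupport (gradient f x)).card ≤ s

/-- The diameter parameter `D = sup_{x, y ∈ K} ‖x - y‖² / 2`. -/
noncomputable def halfSqDiam {d : ℕ} (K : Set (Vec d)) : ℝ :=
  ⨆ p : K × K, ‖(p.1 : Vec d) - (p.2 : Vec d)‖ ^ 2 / 2

/-- The point of `K` nearest to `w` (unique if `K` is nonempty, closed and convex). -/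
noncomputable def nearestPoint {d : ℕ} (K : Set (Vec d)) (w : Vec d) : Vec d :=
  Classical.epsilon fun p => p ∈ K ∧ ∀ z ∈ K, ‖p - w‖ ≤ ‖z - w‖

/-! ### Programs that query a function, with a count of the queries -/

/-- A program with access to an unknown function `X → ℝ`: it either stops with an output or
queries the value of the function at one point and continues depending on the answer. -/
inductive OracleProg (X α : Type) : Type
  | done (a : α) : OracleProg X α
  | query (x : X) (k : ℝ → OracleProg X α) : OracleProg X α

namespace OracleProg

/-- The output of the program when the queried function is `f`. -/
def eval {X α : Type} (f : X → ℝ) : OracleProg X α → α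
  | done a => a
  | query x k => eval f (k (f x))

/-- The number of function values sampled when the queried function is `f`. -/
def numQueries {X α : Type} (f : X → ℝ) : OracleProg X α → ℕ
  | done _ => 0
  | query x k => numQueries f (k (f x)) + 1

/-- Query at `p 0, …, p (n - 1)` in turn and continue with the vector of the answers. -/
def queryVec {X α : Type} :
    (n : ℕ) → (Fin n → X) → ((Fin n → ℝ) → OracleProg X α) → OracleProg X α
  | 0, _, k => k Fin.elim0
  | n + 1, p, k => query (p 0) fun v => queryVec n (fun i => p i.succ) fun w => k (Fin.cons v w)

theorem eval_queryVec {X α : Type} (f : X → ℝ) (n : ℕ) (p : Fin n → X)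
    (k : (Fin n → ℝ) → OracleProg X α) :
    eval f (queryVec n p k) = eval f (k fun i => f (p i)) := by
  induction n with
  | zero =>
    simp only [queryVec]
    congr 2
    exact Subsingleton.elim _ _
  | succ n ih =>
    simp only [queryVec, eval, ih]
    congr 2
    funext i
    refine Fin.cases ?_ (fun j => ?_) i <;> simp

end OracleProg

/-! ### CoSaMP -/

/-- `J` is the index set of `k` entries of `z` of largest modulus (of all entries if `z` has fewer
than `k` entries); ties may be broken in any way. -/
def IsTopIndexSet {d : ℕ} (k : ℕ) (z : Vec d) (J : Finset (Fin d)) : Prop :=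
  J.card = min k d ∧ ∀ i ∈ J, ∀ j, j ∉ J → |z j| ≤ |z i|

/-- `u` is a least squares solution of `M u ≈ y` among the vectors supported in `U`. -/
def IsLeastSquares {m d : ℕ} (M : Matrix (Fin m) (Fin d) ℝ) (y : Vec m) (U : Finset (Fin d))
    (u : Vec d) : Prop :=
  vecSupport u ⊆ U ∧
    ∀ z : Vec d, vecSupport z ⊆ U → ‖y - M.toEuclideanLin u‖ ≤ ‖y - M.toEuclideanLin z‖

/-- The restriction of `u` to the coordinates in `S`, extended by zero. -/
def restrictTo {d : ℕ} (S : Finset (Fin d)) (u : Vec d) : Vec d :=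
  WithLp.toLp 2 fun j => if j ∈ S then u j else 0

/-- `IsCoSaMP M y s n x`: `x` is an `n`-th iterate of CoSaMP with measurement matrix `M`, data `y`
and sparsity level `s`, started at `0`. One iteration adds to the current support the indices of
`2 s` largest entries of `Mᵀ (y - M x)`, solves the least squares problem on the merged index set,
and keeps `s` largest entries of the solution. -/
inductive IsCoSaMP {m d : ℕ} (M : Matrix (Fin m) (Fin d) ℝ) (y : Vec m) (s : ℕ) :
    ℕ → Vec d → Prop
  | zero : IsCoSaMP M y s 0 0
  | succ {n : ℕ} {x : Vec d} (hx : IsCoSaMP M y s n x) {J : Finset (Fin d)}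
      (hJ : IsTopIndexSet (2 * s) (M.transpose.toEuclideanLin (y - M.toEuclideanLin x)) J)
      {u : Vec d} (hu : IsLeastSquares M y (vecSupport x ∪ J) u)
      {S : Finset (Fin d)} (hS : IsTopIndexSet s u S) :
      IsCoSaMP M y s (n + 1) (restrictTo S u)

theorem exists_isTopIndexSet {d : ℕ} (k : ℕ) (z : Vec d) : ∃ J, IsTopIndexSet k z J := by
  induction k with
  | zero => exact ⟨∅, by simp [IsTopIndexSet]⟩
  | succ k ih =>
    obtain ⟨J, hc, hJ⟩ := ih
    by_cases h : Jᶜ.Nonempty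
    · obtain ⟨a, ha, hmax⟩ := Jᶜ.exists_max_image (fun i => |z i|) h
      have haJ : a ∉ J := by simpa using ha
      refine ⟨insert a J, ?_, ?_⟩
      · have hlt : J.card < d := by
          have := Finset.card_lt_univ_of_notMem haJ
          simpa using this
        rw [Finset.card_insert_of_notMem haJ]; omega
      · intro i hi j hj
        rw [Finset.mem_insert] at hi hj
        push Not at hj
        rcases hi with rfl | hi
        · exact hmax j (by simpa using hj.2)
        · exact hJ i hi j hj.2
    · rw [Finset.not_nonempty_iff_eq_empty, Finset.compl_eq_empty_iff] at h
      subst h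
      refine ⟨Finset.univ, ?_, by simp⟩
      simp at hc ⊢; omega

theorem exists_isLeastSquares {m d : ℕ} (M : Matrix (Fin m) (Fin d) ℝ) (y : Vec m)
    (U : Finset (Fin d)) : ∃ u, IsLeastSquares M y U u := by
  let W : Submodule ℝ (Vec d) :=
    { carrier := {z | vecSupport z ⊆ U}
      zero_mem' := by intro i; simp [vecSupport]
      add_mem' := by
        intro a b ha hb i hi
        simp only [vecSupport, Finset.mem_filter, Finset.mem_univ, true_and, Set.mem_ofPred_eq] at *
        by_contra hU
        have h1 : a i = 0 := by
          by_contra h; exact hU (ha (by simp [h]))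
        have h2 : b i = 0 := by
          by_contra h; exact hU (hb (by simp [h]))
        exact hi (by simp [h1, h2])
      smul_mem' := by
        intro c a ha i hi
        apply ha
        simp only [vecSupport, Finset.mem_filter, Finset.mem_univ, true_and] at *
        intro h; exact hi (by simp [h]) }
  let V := W.map M.toEuclideanLin
  have hp := (V.starProjection_apply_mem y)
  obtain ⟨u, hu, hue⟩ := hp
  refine ⟨u, hu, fun z hz => ?_⟩
  rw [hue, V.starProjection_minimal]
  exact ciInf_le ⟨0, by rintro _ ⟨x, rfl⟩; positivity⟩ (⟨_, z, hz, rfl⟩ : V)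

/-- CoSaMP can always be carried out. -/
theorem exists_isCoSaMP {m d : ℕ} (M : Matrix (Fin m) (Fin d) ℝ) (y : Vec m) (s n : ℕ) :
    ∃ x, IsCoSaMP M y s n x := by
  induction n with
  | zero => exact ⟨0, .zero⟩
  | succ n ih =>
    obtain ⟨x, hx⟩ := ih
    obtain ⟨J, hJ⟩ := exists_isTopIndexSet (2 * s)
      (M.transpose.toEuclideanLin (y - M.toEuclideanLin x))
    obtain ⟨u, hu⟩ := exists_isLeastSquares M y (vecSupport x ∪ J)
    obtain ⟨S, hS⟩ := exists_isTopIndexSet s u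
    exact ⟨_, .succ hx hJ hu hS⟩

/-! ### The algorithms -/

/-- The two algorithms: `Z` (Bernoulli measurement matrix) and `E` (Gaussian one). -/
inductive CongoVariant : Type
  | Z
  | E

/-- The law of the entries of the measurement matrix: Rademacher for `Z`, standard normal
for `E`. -/
noncomputable def CongoVariant.entryLaw : CongoVariant → Measure ℝ
  | .Z => (2⁻¹ : ENNReal) • Measure.dirac (1 : ℝ) + (2⁻¹ : ENNReal) • Measure.dirac (-1 : ℝ)
  | .E => gaussianReal 0 1

/-- The `i`-th row of a matrix, as a Euclidean vector. -/
def rowVec {m d : ℕ} (A : Matrix (Fin m) (Fin d) ℝ) (i : Fin m) : Vec d := WithLp.toLp 2 (A i)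

/-- The gradient estimate of one round, at the point `x` with the measurement matrix `A`:
sample at `x` and at `x + (δ / ‖aᵢ‖²) aᵢ` for every row `aᵢ` of `A`, form
`yᵢ = (f (x + (δ / ‖aᵢ‖²) aᵢ) - f x) ‖aᵢ‖² / δ`, run the recovery method on `A / √m` and
`y / √m`, and replace its output by `0` if its norm exceeds `Lf + (7.21 / 2) L δ`. -/
noncomputable def congoEstimate {m d : ℕ}
    (recover : Matrix (Fin m) (Fin d) ℝ → Vec m → Vec d) (Lf L δ : ℝ)
    (A : Matrix (Fin m) (Fin d) ℝ) (x : Vec d) : OracleProg (Vec d) (Vec d) :=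
  .query x fun v₀ =>
    .queryVec m (fun i => x + (δ / ‖rowVec A i‖ ^ 2) • rowVec A i) fun v =>
      let y : Vec m := WithLp.toLp 2 fun i => (v i - v₀) * (‖rowVec A i‖ ^ 2 / δ)
      let g : Vec d := recover ((1 / Real.sqrt m) • A) ((1 / Real.sqrt m) • y)
      open Classical in
      .done (if Lf + 7.21 / 2 * L * δ < ‖g‖ then 0 else g)

/-- The controls of the algorithm on the constraint set `K` with step size `η`, started at `x₁`.
Rounds are numbered from `0`; `f t` and `A t` are the function and the matrix of round `t`. -/
noncomputable def congoControl {m d : ℕ}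
    (recover : Matrix (Fin m) (Fin d) ℝ → Vec m → Vec d) (Lf L η δ : ℝ)
    (K : Set (Vec d)) (x₁ : Vec d) (A : ℕ → Matrix (Fin m) (Fin d) ℝ) (f : ℕ → Vec d → ℝ) :
    ℕ → Vec d
  | 0 => x₁
  | t + 1 =>
    let x := congoControl recover Lf L η δ K x₁ A f t
    nearestPoint K (x - η • (congoEstimate recover Lf L δ (A t) x).eval (f t))

/-! ### Regret -/

/-- The adversarial regret after `T` rounds for given measurement matrices `A`: the supremum, over
all sequences of admissible functions, of the cost of the algorithm minus the smallest cost of a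
fixed control. It is nonnegative, since constant functions are admissible. -/
noncomputable def adversarialRegret {m d : ℕ}
    (recover : Matrix (Fin m) (Fin d) ℝ → Vec m → Vec d) (s : ℕ) (Lf L η δ : ℝ)
    (K : Set (Vec d)) (x₁ : Vec d) (T : ℕ) (A : ℕ → Matrix (Fin m) (Fin d) ℝ) : ENNReal :=
  ⨆ f ∈ {f : ℕ → Vec d → ℝ | ∀ t < T, IsAdmissible K s Lf L (f t)},
    ENNReal.ofReal
      (∑ t ∈ Finset.range T, f t (congoControl recover Lf L η δ K x₁ A f t)
        - ⨅ u : K, ∑ t ∈ Finset.range T, f t u)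

/-- The outer expectation of a nonnegative function that need not be measurable (a supremum over
an uncountable family is not obviously so): the infimum of the expectations of its measurable
majorants. -/
noncomputable def outerExpectation {Ω : Type*} [MeasurableSpace Ω] (P : Measure Ω)
    (X : Ω → ENNReal) : ENNReal :=
  ⨅ (g : Ω → ENNReal) (_ : Measurable g) (_ : X ≤ g), ∫⁻ ω, g ω ∂P

/-- For measurable functions the outer expectation is the usual expectation. -/
theorem outerExpectation_eq_lintegral {Ω : Type*} [MeasurableSpace Ω] (P : Measure Ω)
    {X : Ω → ENNReal} (hX : Measurable X) : outerExpectation P X = ∫⁻ ω, X ω ∂P := by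
  refine le_antisymm ?_ ?_
  · exact iInf_le_of_le X (iInf_le_of_le hX (iInf_le_of_le le_rfl le_rfl))
  · exact le_iInf fun g => le_iInf fun _ => le_iInf fun h => lintegral_mono h

/-! ### Restricted isometries and CoSaMP -/

/-! The gradient at `x_t` is `s`-sparse, and the scaled difference quotients are its inner products
with the rows of `A_t` up to an error `Lδ/2`, so each round is a compressed sensing problem. If
`A_t/√m` is a restricted isometry of order `4s` with constant `1/50`, a CoSaMP iteration shrinks the
error tenfold up to a multiple of the noise (`HasRIP.cosamp_step`). The estimate then lies within `β
= (7.21/2)Lδ`, which is of order `1/T`, of the gradient (`HasRIP.norm_gradient_sub_estimate_le`),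
and the truncation never acts. Projected descent with such estimates has regret at most `D/η +
ηT(Lf+β)²/2 + 2RTβ` (`adversarialRegret_le_of_hasRIP`).

The restricted isometry property concerns all sparse vectors at once. The good event thus depends on
the matrices only, and the bound survives a supremum over functions chosen with knowledge of them.

For a fixed vector of norm at most 1, its products with the rows are independent and sub-Gaussian
with parameter 1 under both entry laws, so the centred energy concentrates
(`measure_le_abs_energy_sub_le`). Nets in the coordinate subspaces leave `d.choose (4s) * 9^(4s)`
vectors to test (`exists_rip_test_vectors`), and the choice of `m` makes the failure probability at
most `1/(2T)²` per round. Over `T` rounds this is `1/(4T)`; on failure the Lipschitz bound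
`2·R·Lf·T` applies, which adds `R·Lf/2` to the expectation.

The factor `max 1 (1/R)` arises because `η` does not scale with the radius: the term `ηT·Lf²/2 =
Lf√T/2` carries no `R`. For `Lf√T ≤ 1` the term `ηTβ²` may be large, but then the Lipschitz bound
alone suffices. -/

theorem norm_sq_restrictTo {d : ℕ} (S : Finset (Fin d)) (z : Vec d) :
    ‖restrictTo S z‖ ^ 2 = ∑ j ∈ S, z j ^ 2 := by
  simp [EuclideanSpace.real_norm_sq_eq, restrictTo, Finset.sum_ite_mem, ite_pow]

theorem inner_restrictTo {d : ℕ} (S : Finset (Fin d)) (w z : Vec d) :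
    inner ℝ w (restrictTo S z) = ∑ j ∈ S, w j * z j := by
  simp [PiLp.inner_apply, restrictTo, Finset.sum_ite_mem, mul_comm]

theorem inner_restrictTo_self {d : ℕ} (S : Finset (Fin d)) (z : Vec d) :
    inner ℝ z (restrictTo S z) = ‖restrictTo S z‖ ^ 2 := by
  rw [inner_restrictTo, norm_sq_restrictTo]
  exact Finset.sum_congr rfl fun j _ => (sq (z j)).symm

theorem vecSupport_restrictTo_subset {d : ℕ} (S : Finset (Fin d)) (z : Vec d) :
    vecSupport (restrictTo S z) ⊆ S := by
  intro j
  simp only [vecSupport, restrictTo, Finset.mem_filter, Finset.mem_univ, true_and]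
  intro h
  by_contra hS
  simp [hS] at h

theorem vecSupport_subset_iff {d : ℕ} {z : Vec d} {S : Finset (Fin d)} :
    vecSupport z ⊆ S ↔ ∀ j, j ∉ S → z j = 0 := by
  simp only [vecSupport, Finset.subset_iff, Finset.mem_filter, Finset.mem_univ, true_and]
  exact ⟨fun h j hj => by by_contra h0; exact hj (h h0), fun h j hj => by
    by_contra h0; exact hj (h j h0)⟩

theorem vecSupport_add_subset {d : ℕ} {x y : Vec d} {S : Finset (Fin d)} (hx : vecSupport x ⊆ S)
    (hy : vecSupport y ⊆ S) : vecSupport (x + y) ⊆ S := by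
  rw [vecSupport_subset_iff] at *
  intro j hj
  simp [hx j hj, hy j hj]

theorem vecSupport_sub_subset {d : ℕ} {x y : Vec d} {S : Finset (Fin d)} (hx : vecSupport x ⊆ S)
    (hy : vecSupport y ⊆ S) : vecSupport (x - y) ⊆ S := by
  rw [vecSupport_subset_iff] at *
  intro j hj
  simp [hx j hj, hy j hj]

theorem vecSupport_smul_subset {d : ℕ} {x : Vec d} {S : Finset (Fin d)} (hx : vecSupport x ⊆ S)
    (a : ℝ) : vecSupport (a • x) ⊆ S := by
  rw [vecSupport_subset_iff] at *
  intro j hj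
  simp [hx j hj]

theorem norm_sq_eq_restrictTo_add_compl {d : ℕ} (S : Finset (Fin d)) (z : Vec d) :
    ‖z‖ ^ 2 = ‖restrictTo S z‖ ^ 2 + ‖restrictTo Sᶜ z‖ ^ 2 := by
  rw [norm_sq_restrictTo, norm_sq_restrictTo, EuclideanSpace.real_norm_sq_eq,
    Finset.sum_add_sum_compl]

theorem norm_restrictTo_le {d : ℕ} (S : Finset (Fin d)) (z : Vec d) : ‖restrictTo S z‖ ≤ ‖z‖ := by
  refine le_of_sq_le_sq ?_ (norm_nonneg _)
  rw [norm_sq_eq_restrictTo_add_compl S z]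
  nlinarith [sq_nonneg ‖restrictTo Sᶜ z‖]

theorem norm_restrictTo_mono {d : ℕ} {S U : Finset (Fin d)} (z : Vec d) (h : S ⊆ U) :
    ‖restrictTo S z‖ ≤ ‖restrictTo U z‖ := by
  refine le_of_sq_le_sq ?_ (norm_nonneg _)
  rw [norm_sq_restrictTo, norm_sq_restrictTo]
  exact Finset.sum_le_sum_of_subset_of_nonneg h fun _ _ _ => sq_nonneg _

theorem norm_le_restrictTo_add_compl {d : ℕ} (S : Finset (Fin d)) (z : Vec d) :
    ‖z‖ ≤ ‖restrictTo S z‖ + ‖restrictTo Sᶜ z‖ := by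
  refine le_of_sq_le_sq ?_ (by positivity)
  rw [norm_sq_eq_restrictTo_add_compl S z]
  nlinarith [mul_nonneg (norm_nonneg (restrictTo S z)) (norm_nonneg (restrictTo Sᶜ z))]

theorem restrictTo_sub {d : ℕ} (S : Finset (Fin d)) (x y : Vec d) :
    restrictTo S (x - y) = restrictTo S x - restrictTo S y := by
  ext j
  by_cases h : j ∈ S <;> simp [restrictTo, h]

/-- An index set of largest entries carries at least as much energy as any set that is not
larger. -/
theorem IsTopIndexSet.sum_sq_sdiff_le {d k : ℕ} {z : Vec d} {J W : Finset (Fin d)}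
    (hJ : IsTopIndexSet k z J) (hW : W.card ≤ J.card) :
    ∑ j ∈ W \ J, z j ^ 2 ≤ ∑ j ∈ J \ W, z j ^ 2 := by
  have hcard : (W \ J).card ≤ (J \ W).card := by
    have h1 := Finset.card_sdiff_add_card_inter W J
    have h2 := Finset.card_sdiff_add_card_inter J W
    rw [Finset.inter_comm] at h2
    omega
  -- A bijection of `W \ J` onto a part of `J \ W` allows an entrywise comparison, since every entry
  -- in `J` dominates every entry outside.
  obtain ⟨T, hT, hTc⟩ := Finset.exists_subset_card_eq hcard
  have e : (W \ J : Finset (Fin d)) ≃ T := Finset.equivOfCardEq hTc.symm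
  calc ∑ j ∈ W \ J, z j ^ 2 = ∑ j : (W \ J : Finset (Fin d)), z j ^ 2 := by
        rw [← Finset.sum_coe_sort]
    _ ≤ ∑ j : (W \ J : Finset (Fin d)), z (e j) ^ 2 := by
        refine Finset.sum_le_sum fun j _ => ?_
        have hj := Finset.mem_sdiff.1 j.2
        have hi := Finset.mem_sdiff.1 (hT (e j).2)
        exact sq_le_sq.2 (hJ.2 _ hi.1 _ hj.2)
    _ = ∑ j : T, z j ^ 2 := e.sum_comp fun j : T => z j ^ 2
    _ = ∑ j ∈ T, z j ^ 2 := Finset.sum_coe_sort T fun j => z j ^ 2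
    _ ≤ ∑ j ∈ J \ W, z j ^ 2 :=
        Finset.sum_le_sum_of_subset_of_nonneg hT fun _ _ _ => sq_nonneg _

/-- The restricted isometry property of order `k` with constant `ε`. -/
def HasRIP {m d : ℕ} (k : ℕ) (ε : ℝ) (M : Matrix (Fin m) (Fin d) ℝ) : Prop :=
  ∀ z : Vec d, (vecSupport z).card ≤ k → |‖M.toEuclideanLin z‖ ^ 2 - ‖z‖ ^ 2| ≤ ε * ‖z‖ ^ 2

/-- Polarisation: a near isometry on a plane nearly preserves inner products there. -/
theorem abs_inner_map_sub_inner_le {E F : Type*} [NormedAddCommGroup E] [InnerProductSpace ℝ E]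
    [NormedAddCommGroup F] [InnerProductSpace ℝ F] (M : E →ₗ[ℝ] F) {u v : E} {ε : ℝ}
    (h : ∀ a b : ℝ, |‖M (a • u + b • v)‖ ^ 2 - ‖a • u + b • v‖ ^ 2| ≤ ε * ‖a • u + b • v‖ ^ 2) :
    |inner ℝ (M u) (M v) - inner ℝ u v| ≤ ε * ‖u‖ * ‖v‖ := by
  rcases eq_or_ne u 0 with rfl | hu
  · simp
  rcases eq_or_ne v 0 with rfl | hv
  · simp
  have hu' := norm_pos_iff.2 hu
  have hv' := norm_pos_iff.2 hv
  -- Cross weights give both summands the norm `‖u‖‖v‖`. Subtracting the bounds for sum and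
  -- difference isolates the inner product, and the parallelogram law evaluates the right-hand side.
  have hp := h ‖v‖ ‖u‖
  have hn := h ‖v‖ (-‖u‖)
  simp only [map_add, map_smul, norm_add_sq_real, inner_smul_left, inner_smul_right, norm_smul,
    Real.norm_eq_abs, abs_neg, abs_norm, mul_pow, RCLike.conj_to_real] at hp hn
  rw [abs_le] at hp hn ⊢
  have hpos : 0 < ‖u‖ * ‖v‖ := by positivity
  constructor <;> refine le_of_mul_le_mul_left ?_ hpos <;> nlinarith

theorem HasRIP.abs_inner_sub_le {m d k : ℕ} {ε : ℝ} {M : Matrix (Fin m) (Fin d) ℝ}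
    (h : HasRIP k ε M) {u v : Vec d} {S : Finset (Fin d)} (hu : vecSupport u ⊆ S)
    (hv : vecSupport v ⊆ S) (hS : S.card ≤ k) :
    |inner ℝ (M.toEuclideanLin u) (M.toEuclideanLin v) - inner ℝ u v| ≤ ε * ‖u‖ * ‖v‖ :=
  abs_inner_map_sub_inner_le _ fun a b => h _ ((Finset.card_le_card (vecSupport_add_subset
    (vecSupport_smul_subset hu a) (vecSupport_smul_subset hv b))).trans hS)

theorem HasRIP.norm_map_le {m d k : ℕ} {M : Matrix (Fin m) (Fin d) ℝ}
    (h : HasRIP k (1 / 50) M) {u : Vec d} (hu : (vecSupport u).card ≤ k) :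
    ‖M.toEuclideanLin u‖ ≤ 1.01 * ‖u‖ := by
  refine le_of_sq_le_sq ?_ (by positivity)
  have := (abs_le.1 (h u hu)).2
  nlinarith [sq_nonneg ‖u‖]

theorem inner_transpose_toEuclideanLin {m d : ℕ} (M : Matrix (Fin m) (Fin d) ℝ) (w : Vec m)
    (p : Vec d) :
    inner ℝ (M.transpose.toEuclideanLin w) p = inner ℝ w (M.toEuclideanLin p) := by
  rw [← Matrix.conjTranspose_eq_transpose_of_trivial, Matrix.toEuclideanLin_conjTranspose_eq_adjoint,
    LinearMap.adjoint_inner_left]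

/-- The proxy `Mᵀ (M r + e)` is close to `r` on small sets. -/
theorem HasRIP.norm_restrictTo_proxy_sub_le {m d k : ℕ} {M : Matrix (Fin m) (Fin d) ℝ}
    (h : HasRIP k (1 / 50) M) (r : Vec d) (e : Vec m) {S W : Finset (Fin d)}
    (hr : vecSupport r ⊆ W) (hSW : (S ∪ W).card ≤ k) :
    ‖restrictTo S (M.transpose.toEuclideanLin (M.toEuclideanLin r + e) - r)‖
      ≤ 1 / 50 * ‖r‖ + 1.01 * ‖e‖ := by
  set v := M.transpose.toEuclideanLin (M.toEuclideanLin r + e) - r with hv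
  set p := restrictTo S v with hp
  have hpS : vecSupport p ⊆ S ∪ W :=
    (vecSupport_restrictTo_subset S v).trans Finset.subset_union_left
  have h1 : ‖p‖ ^ 2 = (inner ℝ (M.toEuclideanLin r) (M.toEuclideanLin p) - inner ℝ r p)
      + inner ℝ e (M.toEuclideanLin p) := by
    rw [hp, ← inner_restrictTo_self, ← hp, hv, inner_sub_left, inner_transpose_toEuclideanLin,
      inner_add_left]
    ring
  have h2 := (abs_le.1 (h.abs_inner_sub_le (hr.trans Finset.subset_union_right) hpS hSW)).2
  have h3 := real_inner_le_norm e (M.toEuclideanLin p)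
  have h4 := h.norm_map_le ((Finset.card_le_card hpS).trans hSW)
  have h5 := mul_le_mul_of_nonneg_left h4 (norm_nonneg e)
  by_contra! hlt
  have hpos : 0 < ‖p‖ := lt_of_le_of_lt (by positivity) hlt
  nlinarith

/-- These are the normal equations: perturbing the minimiser along `w` gives a quadratic in the step
that is nowhere negative. Injectivity of `M` on `U` is not needed. -/
theorem IsLeastSquares.inner_eq_zero {m d : ℕ} {M : Matrix (Fin m) (Fin d) ℝ} {y : Vec m}
    {U : Finset (Fin d)} {u : Vec d} (hu : IsLeastSquares M y U u) {w : Vec d}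
    (hw : vecSupport w ⊆ U) : inner ℝ (y - M.toEuclideanLin u) (M.toEuclideanLin w) = 0 := by
  set a := y - M.toEuclideanLin u with ha
  set b := M.toEuclideanLin w with hb
  have key : ∀ t : ℝ, 0 ≤ -(2 * t * inner ℝ a b) + t ^ 2 * ‖b‖ ^ 2 := by
    intro t
    have h := hu.2 (u + t • w) (vecSupport_add_subset hu.1 (vecSupport_smul_subset hw t))
    have h' : y - M.toEuclideanLin (u + t • w) = a - t • b := by
      rw [map_add, map_smul, ha, hb]; abel
    rw [h'] at h
    have h2 := pow_le_pow_left₀ (norm_nonneg _) h 2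
    rw [norm_sub_sq_real a, inner_smul_right, norm_smul, mul_pow, Real.norm_eq_abs, sq_abs] at h2
    linarith
  by_contra h0
  rcases eq_or_ne ‖b‖ 0 with hb0 | hb0
  · have := norm_eq_zero.1 hb0
    simp [this] at h0
  · have hk := key (inner ℝ a b / ‖b‖ ^ 2)
    have : -(2 * (inner ℝ a b / ‖b‖ ^ 2) * inner ℝ a b) + (inner ℝ a b / ‖b‖ ^ 2) ^ 2 * ‖b‖ ^ 2
        = -(inner ℝ a b ^ 2 / ‖b‖ ^ 2) := by field_simp; ring
    rw [this] at hk
    have : 0 < inner ℝ a b ^ 2 / ‖b‖ ^ 2 := by positivity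
    linarith

/-- Pruning to `s` largest entries at most doubles the distance to an `s`-sparse vector. -/
theorem IsTopIndexSet.norm_sub_restrictTo_le {d s : ℕ} {u x : Vec d} {S : Finset (Fin d)}
    (hS : IsTopIndexSet s u S) (hx : (vecSupport x).card ≤ S.card) :
    ‖x - restrictTo S u‖ ≤ 2 * ‖x - u‖ := by
  have h1 : ‖u - restrictTo S u‖ ≤ ‖x - u‖ := by
    refine le_of_sq_le_sq ?_ (norm_nonneg _)
    have e1 : ‖u - restrictTo S u‖ ^ 2 = ∑ j ∈ Sᶜ, u j ^ 2 := by
      rw [← norm_sq_restrictTo]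
      congr 2
      ext j
      by_cases h : j ∈ S <;> simp [restrictTo, h]
    have e2 : ∑ j ∈ (vecSupport x)ᶜ, u j ^ 2 ≤ ‖x - u‖ ^ 2 := by
      refine le_trans (le_of_eq ?_) (pow_le_pow_left₀ (norm_nonneg _)
        (norm_restrictTo_le (vecSupport x)ᶜ (x - u)) 2)
      rw [norm_sq_restrictTo]
      refine Finset.sum_congr rfl fun j hj => ?_
      have : x j = 0 := by simpa [vecSupport] using hj
      simp [this]
    have e3 := hS.sum_sq_sdiff_le hx
    have e4 := Finset.sum_add_sum_compl S fun j => u j ^ 2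
    have e5 := Finset.sum_add_sum_compl (vecSupport x) fun j => u j ^ 2
    have e6 := Finset.sum_inter_add_sum_sdiff S (vecSupport x) fun j => u j ^ 2
    have e7 := Finset.sum_inter_add_sum_sdiff (vecSupport x) S fun j => u j ^ 2
    rw [Finset.inter_comm] at e7
    rw [e1]
    linarith
  calc ‖x - restrictTo S u‖ = ‖(x - u) + (u - restrictTo S u)‖ := by congr 1; abel
    _ ≤ ‖x - u‖ + ‖u - restrictTo S u‖ := norm_add_le _ _
    _ ≤ 2 * ‖x - u‖ := by linarith

/-- One iteration of CoSaMP contracts the error up to the noise level. -/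
theorem HasRIP.cosamp_step {m d s : ℕ} {M : Matrix (Fin m) (Fin d) ℝ}
    (h : HasRIP (4 * s) (1 / 50) M) (hd : 4 * s ≤ d) {x z u : Vec d} {e y : Vec m}
    (hy : y = M.toEuclideanLin x + e) (hx : (vecSupport x).card ≤ s)
    (hz : (vecSupport z).card ≤ s) {J S : Finset (Fin d)}
    (hJ : IsTopIndexSet (2 * s) (M.transpose.toEuclideanLin (y - M.toEuclideanLin z)) J)
    (hu : IsLeastSquares M y (vecSupport z ∪ J) u) (hS : IsTopIndexSet s u S) :
    ‖x - restrictTo S u‖ ≤ 1 / 10 * ‖x - z‖ + 6.2 * ‖e‖ := by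
  set r := x - z with hr
  set W := vecSupport x ∪ vecSupport z with hW
  have hWc : W.card ≤ 2 * s := (Finset.card_union_le _ _).trans (by omega)
  have hJc : J.card = 2 * s := by rw [hJ.1]; omega
  have hSc : S.card = s := by rw [hS.1]; omega
  have hrW : vecSupport r ⊆ W :=
    vecSupport_sub_subset Finset.subset_union_left Finset.subset_union_right
  have hyr : y - M.toEuclideanLin z = M.toEuclideanLin r + e := by
    rw [hy, hr, map_sub]; abel
  rw [hyr] at hJ
  set v := M.transpose.toEuclideanLin (M.toEuclideanLin r + e) with hv
  -- The order `4s` originates here (`2s` new indices and two supports of size `s`) and again in the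
  -- least squares step, where `U` has up to `3s` indices.
  have hJW : (J ∪ W).card ≤ 4 * s := (Finset.card_union_le _ _).trans (by omega)
  -- the part of `r` missed by the identification step
  have hid : ‖restrictTo (W \ J) r‖ ≤ 2 * (1 / 50 * ‖r‖ + 1.01 * ‖e‖) := by
    have h1 : ‖restrictTo (W \ J) v‖ ≤ ‖restrictTo (J \ W) v‖ := by
      refine le_of_sq_le_sq ?_ (norm_nonneg _)
      rw [norm_sq_restrictTo, norm_sq_restrictTo]
      exact hJ.sum_sq_sdiff_le (by omega)
    have h2 := h.norm_restrictTo_proxy_sub_le r e (S := J \ W) hrW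
      ((Finset.card_le_card (Finset.union_subset_union_left Finset.sdiff_subset)).trans hJW)
    have h3 := h.norm_restrictTo_proxy_sub_le r e (S := W \ J) hrW
      ((Finset.card_le_card (Finset.union_subset (Finset.sdiff_subset.trans
        Finset.subset_union_right) Finset.subset_union_right)).trans hJW)
    have h4 : restrictTo (J \ W) r = 0 := by
      ext j
      by_cases hj : j ∈ J \ W
      · have := vecSupport_subset_iff.1 hrW j (Finset.mem_sdiff.1 hj).2
        simp only [restrictTo, this, ite_self, PiLp.zero_apply]
      · simp only [restrictTo, if_neg hj, PiLp.zero_apply]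
    rw [← hv, restrictTo_sub] at h2 h3
    rw [h4, sub_zero] at h2
    have h5 := norm_sub_norm_le (restrictTo (W \ J) r) (restrictTo (W \ J) v)
    rw [norm_sub_rev] at h5
    linarith
  set U := vecSupport z ∪ J with hU
  have hmiss : ‖restrictTo Uᶜ (x - u)‖ ≤ ‖restrictTo (W \ J) r‖ := by
    have : restrictTo Uᶜ (x - u) = restrictTo (Uᶜ ∩ W) r := by
      ext j
      by_cases hj : j ∈ U
      · simp [restrictTo, hj]
      · have h1 := vecSupport_subset_iff.1 hu.1 j hj
        have h2 : z j = 0 := by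
          have : j ∉ vecSupport z := fun h => hj (Finset.mem_union_left _ h)
          simpa [vecSupport] using this
        by_cases hjW : j ∈ W
        · simp [restrictTo, hj, hjW, h1, h2, hr]
        · have h3 : x j = 0 := by
            have : j ∉ vecSupport x := fun h => hjW (Finset.mem_union_left _ h)
            simpa [vecSupport] using this
          simp [restrictTo, hjW, h1, h3]
    rw [this]
    refine norm_restrictTo_mono _ fun j hj => ?_
    simp only [hU, Finset.mem_inter, Finset.mem_compl, Finset.mem_union, not_or] at hj
    exact Finset.mem_sdiff.2 ⟨hj.2, hj.1.2⟩
  -- the least squares step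
  have hls : ‖restrictTo U (x - u)‖ ≤ 1 / 50 * ‖x - u‖ + 1.01 * ‖e‖ := by
    set p := restrictTo U (x - u) with hp
    have hpU : vecSupport p ⊆ U := vecSupport_restrictTo_subset U _
    have hUx : (U ∪ vecSupport x).card ≤ 4 * s := by
      have h1 := Finset.card_union_le U (vecSupport x)
      have h2 : U.card ≤ _ := Finset.card_union_le (vecSupport z) J
      omega
    have h0 := hu.inner_eq_zero hpU
    have h0' : y - M.toEuclideanLin u = M.toEuclideanLin (x - u) + e := by
      rw [hy, map_sub]; abel
    rw [h0', inner_add_left] at h0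
    have h1 : inner ℝ (x - u) p = ‖p‖ ^ 2 := inner_restrictTo_self U _
    have h2 := (abs_le.1 (h.abs_inner_sub_le (u := x - u) (v := p) (S := U ∪ vecSupport x)
      (vecSupport_sub_subset Finset.subset_union_right (hu.1.trans Finset.subset_union_left))
      (hpU.trans Finset.subset_union_left) hUx)).1
    have h3 := (abs_le.1 (abs_real_inner_le_norm e (M.toEuclideanLin p))).1
    have h4 := h.norm_map_le ((Finset.card_le_card (hpU.trans Finset.subset_union_left)).trans hUx)
    have h5 := mul_le_mul_of_nonneg_left h4 (norm_nonneg e)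
    by_contra! hlt
    have hpos : 0 < ‖p‖ := lt_of_le_of_lt (by positivity) hlt
    nlinarith
  -- Together `‖x - u‖ ≤ (50/49)(‖r‖/25 + 3.03‖e‖)`. Pruning doubles this, giving factors below
  -- `1/10` and `6.2`.
  have hxu := norm_le_restrictTo_add_compl U (x - u)
  have hpr := hS.norm_sub_restrictTo_le (x := x) (by omega)
  have := norm_nonneg r
  have := norm_nonneg e
  linarith

theorem IsCoSaMP.card_vecSupport_le {m d s n : ℕ} {M : Matrix (Fin m) (Fin d) ℝ} {y : Vec m}
    {z : Vec d} (h : IsCoSaMP M y s n z) : (vecSupport z).card ≤ s := by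
  cases h with
  | zero => simp [vecSupport]
  | succ hx hJ hu hS =>
    refine (Finset.card_le_card (vecSupport_restrictTo_subset _ _)).trans ?_
    rw [hS.1]
    exact min_le_left _ _

/-- CoSaMP recovers sparse vectors up to a multiple of the noise. -/
theorem HasRIP.norm_sub_cosamp_le {m d s n : ℕ} {M : Matrix (Fin m) (Fin d) ℝ}
    (h : HasRIP (4 * s) (1 / 50) M) (hd : 4 * s ≤ d) {x z : Vec d} {e y : Vec m}
    (hy : y = M.toEuclideanLin x + e) (hx : (vecSupport x).card ≤ s) (hz : IsCoSaMP M y s n z) :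
    ‖x - z‖ ≤ (1 / 10) ^ n * ‖x‖ + 7 * ‖e‖ := by
  induction hz with
  | zero => simp
  | succ hz hJ hu hS ih =>
    -- The noise constant is stable under iteration: `7/10 + 6.2 ≤ 7`.
    have h1 := h.cosamp_step hd hy hx hz.card_vecSupport_le hJ hu hS
    have := norm_nonneg e
    rw [pow_succ]
    linarith

/-! ### Smooth convex functions and projected gradient descent -/

theorem hasDerivAt_comp_line_of_differentiable {E : Type*} [NormedAddCommGroup E]
    [InnerProductSpace ℝ E] [CompleteSpace E] {f : E → ℝ} (hf : Differentiable ℝ f) (x h : E)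
    (t : ℝ) : HasDerivAt (fun t : ℝ => f (x + t • h)) (inner ℝ (gradient f (x + t • h)) h) t := by
  have h1 : HasDerivAt (fun t : ℝ => x + t • h) h t := by
    simpa using ((hasDerivAt_id t).smul_const h).const_add x
  have h2 := (hf (x + t • h)).hasFDerivAt.comp_hasDerivAt t h1
  rwa [← inner_gradient_left] at h2

namespace IsAdmissible

variable {d s : ℕ} {K : Set (Vec d)} {Lf L : ℝ} {f : Vec d → ℝ}

theorem norm_gradient_le (hf : IsAdmissible K s Lf L f) (hLf : 0 ≤ Lf) (x : Vec d) :
    ‖gradient f x‖ ≤ Lf := by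
  have h : LipschitzWith ⟨Lf, hLf⟩ f := LipschitzWith.of_dist_le_mul fun a b => by
    rw [Real.dist_eq, dist_eq_norm]
    exact hf.lipschitz a b
  have := norm_fderiv_le_of_lipschitz ℝ h (x₀ := x)
  rwa [← toDual_gradient, LinearIsometryEquiv.norm_map] at this

theorem inner_gradient_le (hf : IsAdmissible K s Lf L f) (x h : Vec d) :
    inner ℝ (gradient f x) h ≤ f (x + h) - f x := by
  have hc : ConvexOn ℝ Set.univ fun t : ℝ => f (x + t • h) := by
    have := hf.convex.comp_affineMap (AffineMap.lineMap x (x + h) : ℝ →ᵃ[ℝ] Vec d)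
    refine (this.congr fun t _ => ?_)
    simp [AffineMap.lineMap_apply, add_comm]
  have h1 := hc.le_slope_of_hasDerivAt (Set.mem_univ 0) (Set.mem_univ 1) one_pos
    (hasDerivAt_comp_line_of_differentiable hf.differentiable x h 0)
  simpa [slope_def_field] using h1

/-- The descent lemma: subtracting the quadratic model along the segment leaves a function whose
derivative is nonpositive, by the Lipschitz bound on the gradient. -/
theorem sub_le_inner_gradient_add (hf : IsAdmissible K s Lf L f) (x h : Vec d) :
    f (x + h) - f x ≤ inner ℝ (gradient f x) h + L / 2 * ‖h‖ ^ 2 := by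
  let φ : ℝ → ℝ := fun t => f (x + t • h) - (t * inner ℝ (gradient f x) h + L / 2 * t ^ 2 * ‖h‖ ^ 2)
  have hφ (t : ℝ) : HasDerivAt φ (inner ℝ (gradient f (x + t • h)) h
      - (1 * inner ℝ (gradient f x) h + L / 2 * (2 * t) * ‖h‖ ^ 2)) t := by
    refine (hasDerivAt_comp_line_of_differentiable hf.differentiable x h t).sub
      (((hasDerivAt_id t).mul_const _).add (HasDerivAt.mul_const ?_ _))
    simpa using (hasDerivAt_pow 2 t).const_mul (L / 2)
  have hanti : AntitoneOn φ (Set.Icc 0 1) := by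
    refine antitoneOn_of_deriv_nonpos (convex_Icc 0 1)
      (fun t _ => (hφ t).continuousAt.continuousWithinAt)
      (fun t _ => (hφ t).differentiableAt.differentiableWithinAt) fun t ht => ?_
    rw [interior_Icc] at ht
    rw [(hφ t).deriv]
    have h1 := real_inner_le_norm (gradient f (x + t • h) - gradient f x) h
    have h2 := hf.smooth (x + t • h) x
    rw [add_sub_cancel_left, norm_smul, Real.norm_eq_abs, abs_of_pos ht.1] at h2
    have h3 := mul_le_mul_of_nonneg_right h2 (norm_nonneg h)
    rw [inner_sub_left] at h1
    nlinarith
  have := hanti (Set.left_mem_Icc.2 zero_le_one) (Set.right_mem_Icc.2 zero_le_one) zero_le_one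
  simp only [φ, one_smul, zero_smul, add_zero] at this
  linarith

/-- The scaled difference quotients of a round are noisy linear measurements of the gradient. -/
theorem abs_difference_quotient_sub_le (hf : IsAdmissible K s Lf L f) (hL : 0 ≤ L) {δ : ℝ}
    (hδ : 0 < δ) (x a : Vec d) :
    |(f (x + (δ / ‖a‖ ^ 2) • a) - f x) * (‖a‖ ^ 2 / δ) - inner ℝ (gradient f x) a|
      ≤ L * δ / 2 := by
  -- For a zero row, `δ / 0 = 0` makes the sample point `x` itself, so the quotient and the inner
  -- product both vanish.
  rcases eq_or_ne a 0 with rfl | ha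
  · simp only [norm_zero, inner_zero_right]
    norm_num
    positivity
  have ha' : 0 < ‖a‖ ^ 2 := by positivity
  have h1 := hf.inner_gradient_le x ((δ / ‖a‖ ^ 2) • a)
  have h2 := hf.sub_le_inner_gradient_add x ((δ / ‖a‖ ^ 2) • a)
  rw [norm_smul, mul_pow, Real.norm_eq_abs, sq_abs] at h2
  rw [inner_smul_right] at h1 h2
  have e : (f (x + (δ / ‖a‖ ^ 2) • a) - f x) * (‖a‖ ^ 2 / δ) - inner ℝ (gradient f x) a
      = (f (x + (δ / ‖a‖ ^ 2) • a) - f x - δ / ‖a‖ ^ 2 * inner ℝ (gradient f x) a)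
        * (‖a‖ ^ 2 / δ) := by field_simp
  -- The step has length `δ/‖a‖`, so the rescaled second-order remainder does not depend on the
  -- length of the row.
  have e2 : L * δ / 2 = L / 2 * ((δ / ‖a‖ ^ 2) ^ 2 * ‖a‖ ^ 2) * (‖a‖ ^ 2 / δ) := by
    field_simp
  have h0 : 0 ≤ ‖a‖ ^ 2 / δ := by positivity
  rw [e, abs_of_nonneg (mul_nonneg (by linarith) h0), e2]
  exact mul_le_mul_of_nonneg_right (by linarith) h0

end IsAdmissible

/-! ### Accuracy of the gradient estimate in one round -/

theorem eval_congoEstimate {m d : ℕ} (recover : Matrix (Fin m) (Fin d) ℝ → Vec m → Vec d)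
    (Lf L δ : ℝ) (A : Matrix (Fin m) (Fin d) ℝ) (x : Vec d) (f : Vec d → ℝ) (g : Vec d)
    (hg : g = recover ((1 / Real.sqrt m) • A) ((1 / Real.sqrt m) • WithLp.toLp 2 fun i =>
      (f (x + (δ / ‖rowVec A i‖ ^ 2) • rowVec A i) - f x) * (‖rowVec A i‖ ^ 2 / δ)))
    (hn : ‖g‖ ≤ Lf + 7.21 / 2 * L * δ) : (congoEstimate recover Lf L δ A x).eval f = g := by
  simp only [congoEstimate, OracleProg.eval, OracleProg.eval_queryVec]
  rw [← hg, if_neg (not_lt.2 hn)]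

/-- With a restricted isometry, the gradient estimate of a round is accurate. -/
theorem HasRIP.norm_gradient_sub_estimate_le {m d s n : ℕ} {K : Set (Vec d)} {Lf L δ : ℝ}
    {f : Vec d → ℝ} {A : Matrix (Fin m) (Fin d) ℝ}
    {recover : Matrix (Fin m) (Fin d) ℝ → Vec m → Vec d}
    (hA : HasRIP (4 * s) (1 / 50) ((1 / Real.sqrt m) • A)) (hd : 4 * s ≤ d)
    (hrec : ∀ M y, IsCoSaMP M y s n (recover M y)) (hf : IsAdmissible K s Lf L f)
    (hLf : 0 ≤ Lf) (hL : 0 ≤ L) (hδ : 0 < δ) (hn : (1 / 10) ^ n * Lf ≤ 0.1 * (L * δ))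
    {x : Vec d} (hx : x ∈ K) :
    ‖gradient f x - (congoEstimate recover Lf L δ A x).eval f‖ ≤ 7.21 / 2 * L * δ := by
  set c := 1 / Real.sqrt m with hc
  set y : Vec m := WithLp.toLp 2 fun i =>
    (f (x + (δ / ‖rowVec A i‖ ^ 2) • rowVec A i) - f x) * (‖rowVec A i‖ ^ 2 / δ) with hy
  set e : Vec m := c • (y - A.toEuclideanLin (gradient f x)) with he
  have hye : c • y = (c • A).toEuclideanLin (gradient f x) + e := by
    rw [he, map_smul, LinearMap.smul_apply, smul_sub]; abel
  have hLδ : 0 ≤ L * δ / 2 := by positivity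
  have hnorm : ‖e‖ ≤ L * δ / 2 := by
    refine le_of_sq_le_sq ?_ hLδ
    rw [he, norm_smul, mul_pow, EuclideanSpace.real_norm_sq_eq, Real.norm_eq_abs, sq_abs]
    have h1 : ∑ i, (y - A.toEuclideanLin (gradient f x)) i ^ 2 ≤ m * (L * δ / 2) ^ 2 := by
      refine (Finset.sum_le_card_nsmul _ _ ((L * δ / 2) ^ 2) fun i _ => ?_).trans (by simp)
      rw [← sq_abs]
      refine pow_le_pow_left₀ (abs_nonneg _) ?_ 2
      have h := hf.abs_difference_quotient_sub_le hL hδ x (rowVec A i)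
      have e1 : (A.toEuclideanLin (gradient f x)) i = inner ℝ (gradient f x) (rowVec A i) := by
        rw [PiLp.inner_apply]
        simp [Matrix.toEuclideanLin, Matrix.mulVec, dotProduct, rowVec]
      rwa [← e1] at h
    rcases Nat.eq_zero_or_pos m with rfl | hm
    · simp; positivity
    · have hm' : (0 : ℝ) < m := Nat.cast_pos.2 hm
      rw [hc, div_pow, Real.sq_sqrt hm'.le, one_pow]
      calc 1 / (m : ℝ) * _ ≤ 1 / (m : ℝ) * (m * (L * δ / 2) ^ 2) :=
            mul_le_mul_of_nonneg_left h1 (by positivity)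
        _ = _ := by field_simp
  have hg := hf.norm_gradient_le hLf x
  have hmain := hA.norm_sub_cosamp_le hd hye (hf.sparse x hx) (hrec _ _)
  have hpow : (1 / 10 : ℝ) ^ n * ‖gradient f x‖ ≤ (1 / 10) ^ n * Lf :=
    mul_le_mul_of_nonneg_left hg (by positivity)
  -- The iteration error contributes `0.1·Lδ` and the noise `7·Lδ/2`; the sum `3.6·Lδ` is below
  -- `3.605·Lδ`.
  have hb : ‖gradient f x - recover (c • A) (c • y)‖ ≤ 7.21 / 2 * L * δ := by
    linarith
  rw [eval_congoEstimate recover Lf L δ A x f _ rfl]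
  · exact hb
  -- The truncation is inactive, because the gradient has norm at most `Lf`.
  · have := norm_le_norm_add_norm_sub (gradient f x) (recover (c • A) (c • y))
    rw [norm_sub_rev] at this
    rw [norm_sub_rev] at hb
    linarith

/-! ### Projection and online gradient descent -/

theorem nearestPoint_spec {d : ℕ} {K : Set (Vec d)} (hK : IsCompact K) (hne : K.Nonempty)
    (w : Vec d) : nearestPoint K w ∈ K ∧ ∀ z ∈ K, ‖nearestPoint K w - w‖ ≤ ‖z - w‖ := by
  obtain ⟨p, hp, hmin⟩ := hK.exists_isMinOn hne
    (f := fun z => ‖z - w‖) (by fun_prop)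
  exact Classical.epsilon_spec (p := fun p => p ∈ K ∧ ∀ z ∈ K, ‖p - w‖ ≤ ‖z - w‖)
    ⟨p, hp, fun z hz => hmin hz⟩

/-- The angle at the projection `p` is obtuse: `⟪w - p, u - p⟫ ≤ 0` by the variational inequality,
so replacing `w` by `p` cannot increase the distance to `u`. -/
theorem norm_nearestPoint_sub_le {d : ℕ} {K : Set (Vec d)} (hK : IsCompact K) (hc : Convex ℝ K)
    (w : Vec d) {u : Vec d} (hu : u ∈ K) : ‖nearestPoint K w - u‖ ≤ ‖w - u‖ := by
  obtain ⟨hp, hmin⟩ := nearestPoint_spec hK ⟨u, hu⟩ w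
  set p := nearestPoint K w
  have : Nonempty K := ⟨⟨u, hu⟩⟩
  have h1 : ‖w - p‖ = ⨅ z : K, ‖w - z‖ := by
    refine le_antisymm (le_ciInf fun z => ?_)
      (ciInf_le ⟨0, by rintro _ ⟨x, rfl⟩; exact norm_nonneg _⟩ (⟨p, hp⟩ : K))
    rw [norm_sub_rev, norm_sub_rev w]
    exact hmin z z.2
  have h2 := (norm_eq_iInf_iff_real_inner_le_zero hc hp).1 h1 u hu
  refine le_of_sq_le_sq ?_ (norm_nonneg _)
  have e : w - u = (w - p) - (u - p) := by abel
  rw [e, norm_sub_sq_real (w - p), norm_sub_rev p u]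
  nlinarith [sq_nonneg ‖w - p‖]

/-- The regret of projected gradient descent against linear losses. -/
theorem sum_inner_projected_descent_le {d : ℕ} {K : Set (Vec d)} (hK : IsCompact K)
    (hc : Convex ℝ K) {η : ℝ} {x g : ℕ → Vec d}
    (hx : ∀ t, x (t + 1) = nearestPoint K (x t - η • g t)) {u : Vec d} (hu : u ∈ K) (T : ℕ) :
    2 * η * ∑ t ∈ Finset.range T, inner ℝ (g t) (x t - u) + ‖x T - u‖ ^ 2
      ≤ ‖x 0 - u‖ ^ 2 + η ^ 2 * ∑ t ∈ Finset.range T, ‖g t‖ ^ 2 := by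
  induction T with
  | zero => simp
  | succ T ih =>
    rw [Finset.sum_range_succ, Finset.sum_range_succ, hx T]
    have h1 := pow_le_pow_left₀ (norm_nonneg _)
      (norm_nearestPoint_sub_le hK hc (x T - η • g T) hu) 2
    have e : x T - η • g T - u = (x T - u) - η • g T := by abel
    rw [e, norm_sub_sq_real (x T - u), inner_smul_right, norm_smul, mul_pow, Real.norm_eq_abs,
      sq_abs, real_inner_comm] at h1
    linarith

/-! ### Regret bounds for fixed matrices -/

section Control

variable {m d s : ℕ} {recover : Matrix (Fin m) (Fin d) ℝ → Vec m → Vec d} {Lf L η δ R : ℝ}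
  {K : Set (Vec d)} {x₁ : Vec d} {A : ℕ → Matrix (Fin m) (Fin d) ℝ} {f : ℕ → Vec d → ℝ} {T : ℕ}

theorem congoControl_mem (hK : IsCompact K) (hx₁ : x₁ ∈ K) (t : ℕ) :
    congoControl recover Lf L η δ K x₁ A f t ∈ K := by
  cases t with
  | zero => exact hx₁
  | succ t => exact (nearestPoint_spec hK ⟨x₁, hx₁⟩ _).1

theorem adversarialRegret_le {B : ℝ} (hx₁ : x₁ ∈ K)
    (h : ∀ f : ℕ → Vec d → ℝ, (∀ t < T, IsAdmissible K s Lf L (f t)) → ∀ u ∈ K,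
      ∑ t ∈ Finset.range T, (f t (congoControl recover Lf L η δ K x₁ A f t) - f t u) ≤ B) :
    adversarialRegret recover s Lf L η δ K x₁ T A ≤ ENNReal.ofReal B := by
  have : Nonempty K := ⟨⟨x₁, hx₁⟩⟩
  refine iSup₂_le fun f hf => ENNReal.ofReal_le_ofReal ?_
  rw [sub_le_comm]
  refine le_ciInf fun u => ?_
  have := h f hf u u.2
  rw [Finset.sum_sub_distrib] at this
  linarith

/-- The regret is never larger than the Lipschitz constant permits. -/
theorem adversarialRegret_le_of_lipschitz (hK : IsCompact K) (hR : ∀ x ∈ K, ‖x‖ ≤ R)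
    (hx₁ : x₁ ∈ K) (hLf : 0 ≤ Lf) :
    adversarialRegret recover s Lf L η δ K x₁ T A ≤ ENNReal.ofReal (2 * R * Lf * T) := by
  refine adversarialRegret_le hx₁ fun f hf u hu => ?_
  refine (Finset.sum_le_card_nsmul _ _ (2 * R * Lf) fun t ht => ?_).trans
    (by rw [Finset.card_range, nsmul_eq_mul, mul_comm])
  set x := congoControl recover Lf L η δ K x₁ A f t
  have h1 := (le_abs_self _).trans ((hf t (Finset.mem_range.1 ht)).lipschitz x u)
  have h2 := norm_sub_le x u
  have h3 := hR x (congoControl_mem hK hx₁ t)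
  have h4 := hR u hu
  nlinarith

/-- Convexity linearises each loss at `x t`. Replacing the gradient by its estimate costs at most `β
· 2R` per round by Cauchy–Schwarz, and what remains is the linear regret of projected descent along
the estimates. -/
theorem adversarialRegret_le_of_hasRIP {n : ℕ} {D : ℝ} (hK : IsCompact K) (hc : Convex ℝ K)
    (hR : ∀ x ∈ K, ‖x‖ ≤ R) (hD : ∀ x ∈ K, ∀ y ∈ K, ‖x - y‖ ^ 2 / 2 ≤ D)
    (hx₁ : x₁ ∈ K) (hd : 4 * s ≤ d) (hrec : ∀ M y, IsCoSaMP M y s n (recover M y))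
    (hLf : 0 ≤ Lf) (hL : 0 ≤ L) (hη : 0 < η) (hδ : 0 < δ)
    (hn : (1 / 10) ^ n * Lf ≤ 0.1 * (L * δ))
    (hA : ∀ t < T, HasRIP (4 * s) (1 / 50) ((1 / Real.sqrt m) • A t)) :
    adversarialRegret recover s Lf L η δ K x₁ T A ≤ ENNReal.ofReal
      (D / η + η / 2 * (T * (Lf + 7.21 / 2 * L * δ) ^ 2) + T * (7.21 / 2 * L * δ * (2 * R))) := by
  refine adversarialRegret_le hx₁ fun f hf u hu => ?_
  set x := congoControl recover Lf L η δ K x₁ A f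
  set g := fun t => (congoEstimate recover Lf L δ (A t) (x t)).eval (f t) with hg
  set β := 7.21 / 2 * L * δ with hβ
  have hβ0 : 0 ≤ β := by positivity
  have hxK : ∀ t, x t ∈ K := congoControl_mem hK hx₁
  have herr : ∀ t < T, ‖gradient (f t) (x t) - g t‖ ≤ β := fun t ht =>
    (hA t ht).norm_gradient_sub_estimate_le hd hrec (hf t ht) hLf hL hδ hn (hxK t)
  have hgn : ∀ t < T, ‖g t‖ ≤ Lf + β := fun t ht => by
    have h1 := (hf t ht).norm_gradient_le hLf (x t)
    have h2 := norm_le_norm_add_norm_sub (gradient (f t) (x t)) (g t)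
    have := herr t ht
    linarith
  have hogd := sum_inner_projected_descent_le hK hc (x := x) (g := g) (η := η)
    (fun t => rfl) hu T
  have hsq : ∑ t ∈ Finset.range T, ‖g t‖ ^ 2 ≤ T * (Lf + β) ^ 2 := by
    refine (Finset.sum_le_card_nsmul _ _ ((Lf + β) ^ 2) fun t ht => ?_).trans (by simp)
    exact pow_le_pow_left₀ (norm_nonneg _) (hgn t (Finset.mem_range.1 ht)) 2
  have hstep : ∀ t ∈ Finset.range T,
      f t (x t) - f t u ≤ inner ℝ (g t) (x t - u) + β * (2 * R) := fun t ht => by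
    have h1 := (hf t (Finset.mem_range.1 ht)).inner_gradient_le (x t) (u - x t)
    rw [add_sub_cancel, ← neg_sub (x t) u, inner_neg_right] at h1
    have h2 := real_inner_le_norm (gradient (f t) (x t) - g t) (x t - u)
    rw [inner_sub_left] at h2
    have h3 : ‖x t - u‖ ≤ 2 * R := by
      have := norm_sub_le (x t) u
      linarith [hR _ (hxK t), hR u hu]
    have h4 := mul_le_mul (herr t (Finset.mem_range.1 ht)) h3 (norm_nonneg _) hβ0
    linarith
  have hsum := Finset.sum_le_sum hstep
  rw [Finset.sum_add_distrib, Finset.sum_const, Finset.card_range, nsmul_eq_mul] at hsum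
  have h0 := hD _ (hxK 0) u hu
  have hin : ∑ t ∈ Finset.range T, inner ℝ (g t) (x t - u)
      ≤ D / η + η / 2 * (T * (Lf + β) ^ 2) := by
    refine le_of_mul_le_mul_left ?_ (by positivity : 0 < 2 * η)
    have e : 2 * η * (D / η + η / 2 * (T * (Lf + β) ^ 2))
        = 2 * D + η ^ 2 * (T * (Lf + β) ^ 2) := by field_simp
    rw [e]
    have := mul_le_mul_of_nonneg_left hsq (sq_nonneg η)
    nlinarith [sq_nonneg ‖x T - u‖]
  linarith

end Control

/-! ### Counting the function samples -/

theorem numQueries_queryVec {X α : Type} (f : X → ℝ) (n : ℕ) (p : Fin n → X)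
    (k : (Fin n → ℝ) → OracleProg X α) :
    OracleProg.numQueries f (OracleProg.queryVec n p k)
      = OracleProg.numQueries f (k fun i => f (p i)) + n := by
  induction n with
  | zero =>
    simp only [OracleProg.queryVec, add_zero]
    congr 2
    exact Subsingleton.elim _ _
  | succ n ih =>
    simp only [OracleProg.queryVec, OracleProg.numQueries, ih]
    rw [add_assoc]
    congr 3
    funext i
    refine Fin.cases ?_ (fun j => ?_) i <;> simp

theorem numQueries_congoEstimate {m d : ℕ}
    (recover : Matrix (Fin m) (Fin d) ℝ → Vec m → Vec d) (Lf L δ : ℝ)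
    (A : Matrix (Fin m) (Fin d) ℝ) (x : Vec d) (f : Vec d → ℝ) :
    (congoEstimate recover Lf L δ A x).numQueries f = m + 1 := by
  simp [congoEstimate, OracleProg.numQueries, numQueries_queryVec]

/-! ### Nets and the restricted isometry property -/

/-- Points of the unit ball with mutual distances at least `1 / 4` number at most `9 ^ dim`. -/
theorem card_le_of_quarter_separated {E : Type*} [NormedAddCommGroup E] [NormedSpace ℝ E]
    [FiniteDimensional ℝ E] (s : Finset E) (hs : ∀ c ∈ s, ‖c‖ ≤ 1)
    (h : ∀ c ∈ s, ∀ c' ∈ s, c ≠ c' → 1 / 4 ≤ ‖c - c'‖) :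
    s.card ≤ 9 ^ Module.finrank ℝ E := by
  borelize E
  let μ : Measure E := Measure.addHaar
  -- Volume comparison: disjoint balls of radius `1/8` fit into the ball of radius `9/8`, whence the
  -- base 9.
  have hdisj : Set.Pairwise (s : Set E)
      (Function.onFun Disjoint fun c => Metric.ball c (1 / 8 : ℝ)) := by
    rintro c hc c' hc' hcc
    apply Metric.ball_disjoint_ball
    rw [dist_eq_norm]
    have := h c hc c' hc' hcc
    linarith
  have hsub : ⋃ c ∈ s, Metric.ball c (1 / 8 : ℝ) ⊆ Metric.ball (0 : E) (9 / 8) := by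
    refine Set.iUnion₂_subset fun x hx => Metric.ball_subset_ball' ?_
    rw [dist_zero_right]
    linarith [hs x hx]
  have hvol : (s.card : ENNReal) * ENNReal.ofReal ((1 / 8 : ℝ) ^ Module.finrank ℝ E)
      * μ (Metric.ball 0 1)
      ≤ ENNReal.ofReal ((9 / 8 : ℝ) ^ Module.finrank ℝ E) * μ (Metric.ball 0 1) := by
    refine le_trans (le_of_eq ?_) ((measure_mono hsub).trans_eq
      (μ.addHaar_ball_of_pos _ (by norm_num)))
    rw [measure_biUnion_finset hdisj fun c _ => measurableSet_ball]
    simp only [μ.addHaar_ball_of_pos _ (by norm_num : (0 : ℝ) < 1 / 8), Finset.sum_const,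
      nsmul_eq_mul, mul_assoc]
  have hcard := (ENNReal.mul_le_mul_iff_left (Metric.measure_ball_pos _ _ zero_lt_one).ne'
    measure_ball_lt_top.ne).1 hvol
  have hreal := ENNReal.toReal_le_of_le_ofReal (by positivity) hcard
  rw [ENNReal.toReal_mul, ENNReal.toReal_natCast, ENNReal.toReal_ofReal (by positivity), div_pow,
    div_pow, one_pow] at hreal
  have : (s.card : ℝ) ≤ 9 ^ Module.finrank ℝ E := by
    have h8 : (0 : ℝ) < 8 ^ Module.finrank ℝ E := by positivity
    rw [mul_one_div] at hreal
    exact (div_le_div_iff_of_pos_right h8).1 hreal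
  exact_mod_cast this

/-- A separated set of largest cardinality is a net, since a point far from all its members could be
added. The volume bound makes a largest one exist. -/
theorem exists_quarter_net (E : Type*) [NormedAddCommGroup E] [NormedSpace ℝ E]
    [FiniteDimensional ℝ E] :
    ∃ N : Finset E, (∀ w ∈ N, ‖w‖ ≤ 1) ∧ N.card ≤ 9 ^ Module.finrank ℝ E ∧
      ∀ x : E, ‖x‖ ≤ 1 → ∃ w ∈ N, ‖x - w‖ ≤ 1 / 4 := by
  classical
  let P : ℕ → Prop := fun n => ∃ N : Finset E, N.card = n ∧ (∀ w ∈ N, ‖w‖ ≤ 1) ∧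
    ∀ c ∈ N, ∀ c' ∈ N, c ≠ c' → 1 / 4 ≤ ‖c - c'‖
  have h0 : P 0 := ⟨∅, by simp⟩
  obtain ⟨N, hNc, hN1, hNs⟩ :=
    Nat.findGreatest_spec (P := P) (Nat.zero_le (9 ^ Module.finrank ℝ E)) h0
  refine ⟨N, hN1, card_le_of_quarter_separated N hN1 hNs, fun x hx => ?_⟩
  by_contra! hfar
  have hxN : x ∉ N := fun h => by
    have := hfar x h
    rw [sub_self, norm_zero] at this
    norm_num at this
  have hins1 : ∀ w ∈ insert x N, ‖w‖ ≤ 1 := by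
    intro w hw
    rcases Finset.mem_insert.1 hw with rfl | hw
    exacts [hx, hN1 w hw]
  have hins2 : ∀ c ∈ insert x N, ∀ c' ∈ insert x N, c ≠ c' → 1 / 4 ≤ ‖c - c'‖ := by
    intro c hc c' hc' hne
    rcases Finset.mem_insert.1 hc with rfl | hcN <;> rcases Finset.mem_insert.1 hc' with rfl | hcN'
    · exact absurd rfl hne
    · exact (hfar c' hcN').le
    · rw [norm_sub_rev]; exact (hfar c hcN).le
    · exact hNs c hcN c' hcN' hne
  have := Nat.le_findGreatest (P := P) (card_le_of_quarter_separated _ hins1 hins2)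
    ⟨_, rfl, hins1, hins2⟩
  rw [Finset.card_insert_of_notMem hxN, hNc] at this
  omega

/-- A linear map that nearly preserves the norms of a net nearly preserves all norms. -/
theorem abs_norm_sq_map_sub_le_of_net {E F : Type*} [NormedAddCommGroup E]
    [InnerProductSpace ℝ E] [FiniteDimensional ℝ E] [NormedAddCommGroup F] [InnerProductSpace ℝ F]
    (M : E →ₗ[ℝ] F) {ε : ℝ} {N : Finset E} (hN1 : ∀ w ∈ N, ‖w‖ ≤ 1)
    (hN : ∀ x : E, ‖x‖ ≤ 1 → ∃ w ∈ N, ‖x - w‖ ≤ 1 / 4)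
    (h : ∀ w ∈ N, |‖M w‖ ^ 2 - ‖w‖ ^ 2| ≤ ε / 2) (z : E) :
    |‖M z‖ ^ 2 - ‖z‖ ^ 2| ≤ ε * ‖z‖ ^ 2 := by
  have hM : Continuous M := M.continuous_of_finiteDimensional
  obtain ⟨x, hx, hmax⟩ := (isCompact_closedBall (0 : E) 1).exists_isMaxOn
    ⟨0, Metric.mem_closedBall_self zero_le_one⟩
    (f := fun z => |‖M z‖ ^ 2 - ‖z‖ ^ 2|) (by fun_prop)
  set θ := |‖M x‖ ^ 2 - ‖x‖ ^ 2| with hθ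
  have hhom : ∀ z : E, |‖M z‖ ^ 2 - ‖z‖ ^ 2| ≤ θ * ‖z‖ ^ 2 := by
    intro z
    rcases eq_or_ne z 0 with rfl | hz
    · simp
    have hz' : 0 < ‖z‖ := norm_pos_iff.2 hz
    have h1 := hmax (a := ‖z‖⁻¹ • z) (by simp [norm_smul, hz'.ne'])
    simp only [map_smul, norm_smul, norm_inv, norm_norm, mul_pow, Set.mem_ofPred_eq] at h1
    rw [← mul_sub, abs_mul, abs_of_nonneg (by positivity), ← hθ, inv_pow,
      inv_mul_le_iff₀ (by positivity)] at h1
    linarith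
  have hx1 : ‖x‖ ≤ 1 := by simpa using hx
  obtain ⟨w, hw, hxw⟩ := hN x hx1
  -- The deviations at the maximiser `x` and at a net point `w` differ by the bilinear form at `(x -
  -- w, x + w)`, which is at most `θ · (1/4) · 2`. Hence `θ ≤ ε/2 + θ/2`.
  have hb := abs_inner_map_sub_inner_le M (u := x - w) (v := x + w) (ε := θ) fun a b => hhom _
  have e : inner ℝ (M (x - w)) (M (x + w)) - inner ℝ (x - w) (x + w)
      = (‖M x‖ ^ 2 - ‖x‖ ^ 2) - (‖M w‖ ^ 2 - ‖w‖ ^ 2) := by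
    simp only [map_sub, map_add, inner_sub_left, inner_add_right, real_inner_self_eq_norm_sq]
    rw [real_inner_comm (M w) (M x), real_inner_comm w x]
    ring
  rw [e] at hb
  have h1 := abs_sub_abs_le_abs_sub (‖M x‖ ^ 2 - ‖x‖ ^ 2) (‖M w‖ ^ 2 - ‖w‖ ^ 2)
  have h2 := h w hw
  have h3 : ‖x + w‖ ≤ 2 := (norm_add_le _ _).trans (by linarith [hN1 w hw])
  have h4 : θ * ‖x - w‖ * ‖x + w‖ ≤ θ * (1 / 4) * 2 :=
    mul_le_mul (mul_le_mul_of_nonneg_left hxw (abs_nonneg _)) h3 (norm_nonneg _)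
      (by positivity)
  have hθε : θ ≤ ε := by linarith
  exact (hhom z).trans (mul_le_mul_of_nonneg_right hθε (sq_nonneg _))

/-- The vectors supported in `S`. -/
def supportedIn {d : ℕ} (S : Finset (Fin d)) : Submodule ℝ (Vec d) where
  carrier := {z | vecSupport z ⊆ S}
  zero_mem' := by simp [vecSupport]
  add_mem' := vecSupport_add_subset
  smul_mem' := fun a _ hx => vecSupport_smul_subset hx a

theorem finrank_supportedIn_le {d : ℕ} (S : Finset (Fin d)) :
    Module.finrank ℝ (supportedIn S) ≤ S.card := by
  let φ : supportedIn S →ₗ[ℝ] (S → ℝ) :=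
    { toFun := fun z j => (z : Vec d) j
      map_add' := fun _ _ => rfl
      map_smul' := fun _ _ => rfl }
  have hφ : Function.Injective φ := by
    intro y z hyz
    ext j
    by_cases hj : j ∈ S
    · exact congrFun hyz ⟨j, hj⟩
    · rw [vecSupport_subset_iff.1 y.2 j hj, vecSupport_subset_iff.1 z.2 j hj]
  simpa using LinearMap.finrank_le_finrank_of_injective hφ

/-- Finitely many test vectors decide the isometry property on the vectors supported in `S`. -/
theorem exists_test_vectors {d : ℕ} (S : Finset (Fin d)) :
    ∃ N : Finset (Vec d), (∀ w ∈ N, ‖w‖ ≤ 1) ∧ N.card ≤ 9 ^ S.card ∧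
      ∀ (m : ℕ) (M : Matrix (Fin m) (Fin d) ℝ) (ε : ℝ),
        (∀ w ∈ N, |‖M.toEuclideanLin w‖ ^ 2 - ‖w‖ ^ 2| ≤ ε / 2) →
        ∀ z : Vec d, vecSupport z ⊆ S →
          |‖M.toEuclideanLin z‖ ^ 2 - ‖z‖ ^ 2| ≤ ε * ‖z‖ ^ 2 := by
  classical
  obtain ⟨N, hN1, hNc, hN⟩ := exists_quarter_net (supportedIn S)
  refine ⟨N.image Subtype.val, ?_, ?_, fun m M ε h z hz => ?_⟩
  · intro w hw
    obtain ⟨v, hv, rfl⟩ := Finset.mem_image.1 hw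
    exact hN1 v hv
  · exact (Finset.card_image_le.trans hNc).trans
      (Nat.pow_le_pow_right (by norm_num) (finrank_supportedIn_le S))
  · exact abs_norm_sq_map_sub_le_of_net (M.toEuclideanLin.comp (supportedIn S).subtype) hN1 hN
      (fun w hw => h w (Finset.mem_image_of_mem _ hw)) ⟨z, hz⟩

/-- Finitely many test vectors decide the restricted isometry property. -/
theorem exists_rip_test_vectors {d k : ℕ} (hk : k ≤ d) :
    ∃ N : Finset (Vec d), (∀ w ∈ N, ‖w‖ ≤ 1) ∧ N.card ≤ d.choose k * 9 ^ k ∧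
      ∀ (m : ℕ) (M : Matrix (Fin m) (Fin d) ℝ) (ε : ℝ),
        (∀ w ∈ N, |‖M.toEuclideanLin w‖ ^ 2 - ‖w‖ ^ 2| ≤ ε / 2) → HasRIP k ε M := by
  classical
  choose N hN1 hNc hN using fun S : Finset (Fin d) => exists_test_vectors S
  refine ⟨(Finset.powersetCard k Finset.univ).biUnion N, ?_, ?_, fun m M ε h z hz => ?_⟩
  · intro w hw
    obtain ⟨S, -, hw⟩ := Finset.mem_biUnion.1 hw
    exact hN1 S w hw
  · refine (Finset.card_biUnion_le_card_mul _ _ (9 ^ k) fun S hS => ?_).trans_eq (by simp)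
    have := hNc S
    rwa [(Finset.mem_powersetCard.1 hS).2] at this
  -- Smaller supports are enlarged to exactly `k` indices, possible because `k ≤ d`; thus only
  -- `d.choose k` subspaces occur.
  · obtain ⟨S, hzS, hS⟩ := Finset.exists_superset_card_eq hz (by simpa using hk)
    exact hN S m M ε (fun w hw => h w (Finset.mem_biUnion.2
      ⟨S, Finset.mem_powersetCard.2 ⟨Finset.subset_univ _, hS⟩, hw⟩)) z hzS

/-! ### Concentration of the energy of random measurements -/

/-- The weight `exp (x²/4)` turns the density of variance 1 into `√2` times that of variance 2. -/
theorem lintegral_exp_sq_div_four_gaussianReal :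
    ∫⁻ x, ENNReal.ofReal (Real.exp (x ^ 2 / 4)) ∂(gaussianReal 0 1)
      = ENNReal.ofReal (Real.sqrt 2) := by
  rw [gaussianReal_of_var_ne_zero _ one_ne_zero,
    lintegral_withDensity_eq_lintegral_mul _ (measurable_gaussianPDF 0 1) (by fun_prop)]
  have e : ∀ x : ℝ, (gaussianPDF 0 1 * fun x => ENNReal.ofReal (Real.exp (x ^ 2 / 4))) x
      = ENNReal.ofReal (Real.sqrt 2) * ENNReal.ofReal (gaussianPDFReal 0 2 x) := by
    intro x
    rw [Pi.mul_apply, gaussianPDF, ← ENNReal.ofReal_mul (gaussianPDFReal_nonneg _ _ _),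
      ← ENNReal.ofReal_mul (Real.sqrt_nonneg _)]
    congr 1
    simp only [gaussianPDFReal, NNReal.coe_one, NNReal.coe_ofNat, mul_one, sub_zero]
    rw [mul_assoc, ← Real.exp_add, ← mul_assoc, mul_comm (2 * Real.pi) 2,
      Real.sqrt_mul (by norm_num : (0 : ℝ) ≤ 2) (2 * Real.pi), mul_inv, ← mul_assoc,
      mul_inv_cancel₀ (by positivity), one_mul]
    congr 2
    ring
  simp_rw [e]
  rw [lintegral_const_mul _ (by fun_prop), lintegral_gaussianPDFReal_eq_one _ two_ne_zero, mul_one]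

theorem lintegral_exp_mul_gaussianReal (t : ℝ) :
    ∫⁻ x, ENNReal.ofReal (Real.exp (t * x)) ∂(gaussianReal 0 1)
      = ENNReal.ofReal (Real.exp (t ^ 2 / 2)) := by
  rw [← ofReal_integral_eq_lintegral_ofReal (integrable_exp_mul_gaussianReal t)
    (ae_of_all _ fun x => (Real.exp_pos _).le)]
  have := congrFun (mgf_id_gaussianReal (μ := 0) (v := 1)) t
  simp only [mgf, id] at this
  rw [this]
  simp

section Subgaussian

variable {Ω : Type*} [MeasurableSpace Ω] {P : Measure Ω} {Z : Ω → ℝ}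

/-- Square exponential moments of a sub-Gaussian variable, by decoupling with a Gaussian. -/
theorem lintegral_exp_sq_div_four_le [IsProbabilityMeasure P] (hZ : HasSubgaussianMGF Z 1 P) :
    ∫⁻ ω, ENNReal.ofReal (Real.exp (Z ω ^ 2 / 4)) ∂P ≤ ENNReal.ofReal (Real.sqrt 2) := by
  have hs : Real.sqrt 2 ^ 2 = 2 := Real.sq_sqrt (by norm_num)
  -- With an independent standard normal `g`, `exp (Z²/4)` is the mean of `exp (Zg/√2)` over `g`.
  -- After exchanging the integrals, the sub-Gaussian bound in `Z` leaves the Gaussian moment of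
  -- `exp (g²/4)`.
  have h1 : ∀ ω, ENNReal.ofReal (Real.exp (Z ω ^ 2 / 4)) = ∫⁻ x, ENNReal.ofReal
      (Real.exp (Z ω / Real.sqrt 2 * x)) ∂(gaussianReal 0 1) := by
    intro ω
    rw [lintegral_exp_mul_gaussianReal, div_pow, hs]
    congr 2
    ring
  simp_rw [h1]
  have hZm : AEMeasurable (fun p : Ω × ℝ => Z p.1) (P.prod (gaussianReal 0 1)) :=
    hZ.aemeasurable.comp_quasiMeasurePreserving Measure.quasiMeasurePreserving_fst
  rw [lintegral_lintegral_swap (by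
    refine (Real.measurable_exp.comp_aemeasurable ?_).ennreal_ofReal
    exact (hZm.div_const _).mul measurable_snd.aemeasurable)]
  rw [← lintegral_exp_sq_div_four_gaussianReal]
  refine lintegral_mono fun x => ?_
  have h2 := hZ.mgf_le (x / Real.sqrt 2)
  have h3 := hZ.integrable_exp_mul (x / Real.sqrt 2)
  have e : ∀ ω, Z ω / Real.sqrt 2 * x = x / Real.sqrt 2 * Z ω := fun ω => by ring
  simp_rw [e]
  rw [← ofReal_integral_eq_lintegral_ofReal h3 (ae_of_all _ fun ω => (Real.exp_pos _).le)]
  refine ENNReal.ofReal_le_ofReal (h2.trans_eq ?_)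
  rw [div_pow, hs]
  congr 1
  simp
  ring

theorem integrable_exp_sq_div_four [IsProbabilityMeasure P] (hZ : HasSubgaussianMGF Z 1 P) :
    Integrable (fun ω => Real.exp (Z ω ^ 2 / 4)) P := by
  refine ⟨(Real.measurable_exp.comp_aemeasurable
    ((hZ.aemeasurable.pow_const 2).div_const 4)).aestronglyMeasurable, ?_⟩
  rw [hasFiniteIntegral_iff_ofReal (ae_of_all _ fun ω => (Real.exp_pos _).le)]
  exact (lintegral_exp_sq_div_four_le hZ).trans_lt ENNReal.ofReal_lt_top

theorem integral_exp_sq_div_four_le [IsProbabilityMeasure P] (hZ : HasSubgaussianMGF Z 1 P) :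
    ∫ ω, Real.exp (Z ω ^ 2 / 4) ∂P ≤ Real.sqrt 2 := by
  have h := lintegral_exp_sq_div_four_le hZ
  rw [← ofReal_integral_eq_lintegral_ofReal (integrable_exp_sq_div_four hZ)
    (ae_of_all _ fun ω => (Real.exp_pos _).le)] at h
  exact (ENNReal.ofReal_le_ofReal_iff (Real.sqrt_nonneg _)).1 h

theorem exp_le_one_add_add_sq_mul_exp_abs (u : ℝ) :
    Real.exp u ≤ 1 + u + u ^ 2 * Real.exp |u| := by
  have h1 : 1 ≤ Real.exp |u| := Real.one_le_exp (abs_nonneg u)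
  rcases le_or_gt |u| 1 with h | h
  · have := (abs_le.1 (Real.abs_exp_sub_one_sub_id_le h)).2
    nlinarith [sq_nonneg u]
  · rcases le_or_gt 0 u with hu | hu
    · rw [abs_of_nonneg hu] at *
      nlinarith [sq_nonneg (u - 1)]
    · have h2 : Real.exp u ≤ 1 := Real.exp_le_one_iff.2 hu.le
      rw [abs_of_neg hu] at *
      nlinarith [sq_nonneg u]

/-- The linear term is kept exact so that it vanishes on integration when `v` is the second moment.
The remainder is of order `l²` and is dominated by the exponential moment that is under control. -/
theorem exp_mul_sq_sub_le {l v : ℝ} (hl : |l| ≤ 1 / 8) (hv0 : 0 ≤ v) (hv1 : v ≤ 1) (z : ℝ) :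
    Real.exp (l * (z ^ 2 - v))
      ≤ 1 + l * (z ^ 2 - v) + 128 * Real.exp (1 / 4) * l ^ 2 * Real.exp (z ^ 2 / 4) := by
  set w := z ^ 2 + 1 with hw
  have hw0 : 0 ≤ w := by positivity
  have habs : |z ^ 2 - v| ≤ w := by
    rw [abs_le]
    constructor <;> nlinarith [sq_nonneg z]
  have h1 : |l * (z ^ 2 - v)| ≤ w / 8 := by
    rw [abs_mul]
    exact (mul_le_mul hl habs (abs_nonneg _) (by norm_num)).trans_eq (by ring)
  have h2 : (l * (z ^ 2 - v)) ^ 2 ≤ l ^ 2 * w ^ 2 := by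
    rw [mul_pow, ← sq_abs (z ^ 2 - v)]
    exact mul_le_mul_of_nonneg_left (pow_le_pow_left₀ (abs_nonneg _) habs 2) (sq_nonneg _)
  have h3 : w ^ 2 ≤ 128 * Real.exp (w / 8) := by
    have := Real.pow_div_factorial_le_exp (x := w / 8) (by positivity) 2
    norm_num [Nat.factorial] at this
    linarith
  have h4 : Real.exp (w / 8) * Real.exp (w / 8) = Real.exp (1 / 4) * Real.exp (z ^ 2 / 4) := by
    rw [← Real.exp_add, ← Real.exp_add, hw]
    congr 1
    ring
  refine (exp_le_one_add_add_sq_mul_exp_abs _).trans (add_le_add le_rfl ?_)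
  calc (l * (z ^ 2 - v)) ^ 2 * Real.exp |l * (z ^ 2 - v)|
      ≤ (l ^ 2 * w ^ 2) * Real.exp (w / 8) :=
        mul_le_mul h2 (Real.exp_le_exp.2 h1) (Real.exp_pos _).le (by positivity)
    _ ≤ (l ^ 2 * (128 * Real.exp (w / 8))) * Real.exp (w / 8) := by gcongr
    _ = 128 * l ^ 2 * (Real.exp (w / 8) * Real.exp (w / 8)) := by ring
    _ = 128 * Real.exp (1 / 4) * l ^ 2 * Real.exp (z ^ 2 / 4) := by rw [h4]; ring

/-- The square of a sub-Gaussian variable is sub-exponential. -/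
theorem lintegral_exp_mul_sq_sub_le [IsProbabilityMeasure P] (hZ : HasSubgaussianMGF Z 1 P)
    {l v : ℝ} (hl : |l| ≤ 1 / 8) (hv : ∫ ω, Z ω ^ 2 ∂P = v) (hv0 : 0 ≤ v) (hv1 : v ≤ 1) :
    ∫⁻ ω, ENNReal.ofReal (Real.exp (l * (Z ω ^ 2 - v))) ∂P
      ≤ ENNReal.ofReal (Real.exp (256 * l ^ 2)) := by
  have hsq : Integrable (fun ω => Z ω ^ 2) P := (hZ.memLp 2).integrable_sq
  have hcen : Integrable (fun ω => l * (Z ω ^ 2 - v)) P :=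
    (hsq.sub (integrable_const v)).const_mul l
  have hlin : Integrable (fun ω => 1 + l * (Z ω ^ 2 - v)) P := (integrable_const 1).add hcen
  have hexp : Integrable
      (fun ω => 128 * Real.exp (1 / 4) * l ^ 2 * Real.exp (Z ω ^ 2 / 4)) P :=
    (integrable_exp_sq_div_four hZ).const_mul _
  refine (lintegral_mono fun ω => ENNReal.ofReal_le_ofReal
    (exp_mul_sq_sub_le hl hv0 hv1 (Z ω))).trans ?_
  refine (ofReal_integral_eq_lintegral_ofReal (hlin.add hexp) (ae_of_all _ fun ω =>
    (Real.exp_pos _).le.trans (exp_mul_sq_sub_le hl hv0 hv1 (Z ω)))).ge.trans ?_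
  refine ENNReal.ofReal_le_ofReal ?_
  have e1 : ∫ ω, (1 + l * (Z ω ^ 2 - v)) ∂P = 1 := by
    rw [integral_add (integrable_const 1) hcen,
      integral_const_mul, integral_sub hsq (integrable_const v), hv]
    simp
  simp only [Pi.add_apply]
  rw [integral_add hlin hexp, e1, integral_const_mul]
  have h1 := integral_exp_sq_div_four_le hZ
  -- The constant of the second-order term is `128 · (4/3) · (3/2) = 256`.
  have h2 : Real.exp (1 / 4) ≤ 4 / 3 := by
    have := Real.exp_bound_div_one_sub_of_interval (x := 1 / 4) (by norm_num) (by norm_num)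
    norm_num at this ⊢
    exact this
  have h3 : Real.sqrt 2 ≤ 3 / 2 := Real.sqrt_le_iff.2 (by norm_num)
  have h0 : 0 ≤ ∫ ω, Real.exp (Z ω ^ 2 / 4) ∂P := integral_nonneg fun ω => (Real.exp_pos _).le
  have h4 : Real.exp (1 / 4) * ∫ ω, Real.exp (Z ω ^ 2 / 4) ∂P ≤ 2 :=
    (mul_le_mul h2 (h1.trans h3) h0 (by norm_num)).trans_eq (by norm_num)
  have h5 := Real.add_one_le_exp (256 * l ^ 2)
  nlinarith [sq_nonneg l]

end Subgaussian

/-! ### Independent rows and concentration of the energy -/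

section Rows

variable {Ω : Type*} [MeasurableSpace Ω] {P : Measure Ω} {ι κ : Type*} [Fintype κ]
  {X : ι × κ → Ω → ℝ}

/-- The rows of an array of independent variables are independent. -/
theorem lintegral_prod_rows [IsProbabilityMeasure P] (hX : iIndepFun X P)
    (hm : ∀ p, AEMeasurable (X p) P) {G : (κ → ℝ) → ENNReal} (hG : Measurable G)
    (s : Finset ι) :
    ∫⁻ ω, ∏ i ∈ s, G (fun j => X (i, j) ω) ∂P
      = ∏ i ∈ s, ∫⁻ ω, G (fun j => X (i, j) ω) ∂P := by
  classical
  have hrow : ∀ i, AEMeasurable (fun ω => G (fun j => X (i, j) ω)) P := fun i =>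
    hG.comp_aemeasurable (aemeasurable_pi_lambda _ fun j => hm (i, j))
  induction s using Finset.induction_on with
  | empty => simp
  | insert i₀ s hi ih =>
    simp only [Finset.prod_insert hi]
    rw [← ih]
    refine lintegral_mul_eq_lintegral_mul_lintegral_of_indepFun'' (hrow i₀)
      (Finset.aemeasurable_fun_prod _ fun i _ => hrow i) ?_
    -- The new row and the earlier rows depend on disjoint blocks of the array, and functions of
    -- disjoint blocks are independent.
    set B : Finset (ι × κ) := {i₀} ×ˢ Finset.univ with hB
    set B' : Finset (ι × κ) := s ×ˢ Finset.univ with hB'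
    have hdisj : Disjoint B B' := by
      rw [Finset.disjoint_left]
      rintro ⟨i, j⟩ h1 h2
      simp only [hB, hB', Finset.mem_product, Finset.mem_singleton, Finset.mem_univ,
        and_true] at h1 h2
      exact hi (h1 ▸ h2)
    have hind := hX.indepFun_finset₀ B B' hdisj hm
    have hφ : Measurable fun y : B → ℝ => G fun j => y ⟨(i₀, j), by simp [hB]⟩ :=
      hG.comp (measurable_pi_lambda _ fun j => measurable_pi_apply _)
    have hψ : Measurable fun y : B' → ℝ =>
        ∏ i ∈ s.attach, G fun j => y ⟨(i, j), by simp [hB']⟩ :=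
      Finset.measurable_prod _ fun i _ =>
        hG.comp (measurable_pi_lambda _ fun j => measurable_pi_apply _)
    have h := hind.comp hφ hψ
    have e : (fun ω => ∏ i ∈ s, G fun j => X (i, j) ω)
        = (fun y : B' → ℝ => ∏ i ∈ s.attach, G fun j => y ⟨(i, j), by simp [hB']⟩)
          ∘ fun ω p => X p ω :=
      funext fun ω => (Finset.prod_attach s fun i => G fun j => X (i, j) ω).symm
    rw [e]
    exact h

/-- Scaling multiplies the parameter by `x j ^ 2` and independence adds the parameters; their sum is
then relaxed to 1. -/
theorem hasSubgaussianMGF_row [IsProbabilityMeasure P] (hX : iIndepFun X P)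
    (hs : ∀ p, HasSubgaussianMGF (X p) 1 P) (x : κ → ℝ) (hx : ∑ j, x j ^ 2 ≤ 1) (i : ι) :
    HasSubgaussianMGF (fun ω => ∑ j, x j * X (i, j) ω) 1 P := by
  have hrow : iIndepFun (fun j ω => x j * X (i, j) ω) P :=
    (hX.precomp (g := fun j => (i, j)) (Prod.mk_right_injective i)).comp
      (fun j y => x j * y) fun j => by fun_prop
  have hterm : ∀ j, HasSubgaussianMGF (fun ω => x j * X (i, j) ω) (x j ^ 2).toNNReal P := by
    refine fun j => ⟨fun t => ?_, fun t => ?_⟩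
    · simp_rw [← mul_assoc]
      exact (hs (i, j)).integrable_exp_mul (t * x j)
    · rw [mgf_const_mul]
      refine ((hs (i, j)).mgf_le (x j * t)).trans_eq ?_
      rw [Real.coe_toNNReal _ (sq_nonneg _), NNReal.coe_one]
      ring_nf
  have h := HasSubgaussianMGF.sum_of_iIndepFun hrow (s := Finset.univ) fun j _ => hterm j
  refine ⟨h.integrable_exp_mul, fun t => (h.mgf_le t).trans (Real.exp_le_exp.2 ?_)⟩
  rw [NNReal.coe_sum]
  simp only [Real.coe_toNNReal _ (sq_nonneg _)]
  have := mul_le_mul_of_nonneg_right hx (sq_nonneg t)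
  simp only [NNReal.coe_one]
  linarith

/-- The row product is centred, so its second moment is a variance, which is additive by
independence. -/
theorem integral_sq_row [IsProbabilityMeasure P] (hX : iIndepFun X P)
    (hs : ∀ p, HasSubgaussianMGF (X p) 1 P) (h0 : ∀ p, ∫ ω, X p ω ∂P = 0)
    (h1 : ∀ p, ∫ ω, X p ω ^ 2 ∂P = 1) (x : κ → ℝ) (i : ι) :
    ∫ ω, (∑ j, x j * X (i, j) ω) ^ 2 ∂P = ∑ j, x j ^ 2 := by
  have hrow : iIndepFun (fun j ω => x j * X (i, j) ω) P :=
    (hX.precomp (g := fun j => (i, j)) (Prod.mk_right_injective i)).comp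
      (fun j y => x j * y) fun j => by fun_prop
  have hint : ∀ j, Integrable (fun ω => x j * X (i, j) ω) P := fun j =>
    (hs (i, j)).integrable.const_mul _
  have hmean : ∫ ω, (∑ j, x j * X (i, j) ω) ∂P = 0 := by
    rw [integral_finsetSum _ fun j _ => hint j]
    simp [integral_const_mul, h0]
  rw [← variance_of_integral_eq_zero
    (Finset.aemeasurable_fun_sum _ fun j _ => (hint j).aemeasurable) hmean]
  have hv := IndepFun.variance_sum (μ := P) (X := fun j ω => x j * X (i, j) ω) (s := Finset.univ)
    (fun j _ => ((hs (i, j)).memLp 2).const_mul (x j)) fun j _ j' _ hjj => hrow.indepFun hjj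
  have e : (∑ j, fun ω => x j * X (i, j) ω) = fun ω => ∑ j, x j * X (i, j) ω := by
    ext ω; simp
  rw [e] at hv
  rw [hv]
  refine Finset.sum_congr rfl fun j _ => ?_
  rw [variance_const_mul, variance_of_integral_eq_zero (hs _).aemeasurable (h0 _), h1, mul_one]

variable [Fintype ι]

/-- Exponential moments of the centred energy of a random projection. -/
theorem lintegral_exp_energy_le [IsProbabilityMeasure P] (hX : iIndepFun X P)
    (hs : ∀ p, HasSubgaussianMGF (X p) 1 P) (h0 : ∀ p, ∫ ω, X p ω ∂P = 0)
    (h1 : ∀ p, ∫ ω, X p ω ^ 2 ∂P = 1) (x : κ → ℝ) (hx : ∑ j, x j ^ 2 ≤ 1) {l : ℝ}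
    (hl : |l| ≤ 1 / 8) :
    ∫⁻ ω, ENNReal.ofReal (Real.exp (l * ∑ i : ι, ((∑ j, x j * X (i, j) ω) ^ 2 - ∑ j, x j ^ 2))) ∂P
      ≤ ENNReal.ofReal (Real.exp (256 * l ^ 2 * Fintype.card ι)) := by
  set v := ∑ j, x j ^ 2
  have e : ∀ ω, ENNReal.ofReal (Real.exp (l * ∑ i : ι, ((∑ j, x j * X (i, j) ω) ^ 2 - v)))
      = ∏ i : ι, ENNReal.ofReal (Real.exp (l * ((∑ j, x j * X (i, j) ω) ^ 2 - v))) := by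
    intro ω
    rw [Finset.mul_sum, Real.exp_sum, ENNReal.ofReal_prod_of_nonneg fun i _ => (Real.exp_pos _).le]
  simp_rw [e]
  rw [lintegral_prod_rows hX (fun p => (hs p).aemeasurable)
    (G := fun y => ENNReal.ofReal (Real.exp (l * ((∑ j, x j * y j) ^ 2 - v)))) (by fun_prop)]
  calc _ ≤ ∏ i : ι, ENNReal.ofReal (Real.exp (256 * l ^ 2)) :=
        Finset.prod_le_prod' fun i _ => lintegral_exp_mul_sq_sub_le
          (hasSubgaussianMGF_row hX hs x hx i) hl (integral_sq_row hX hs h0 h1 x i)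
          (Finset.sum_nonneg fun j _ => sq_nonneg _) hx
    _ = _ := by
        rw [Finset.prod_const, ← ENNReal.ofReal_pow (Real.exp_pos _).le, ← Real.exp_nat_mul,
          Finset.card_univ, mul_comm]

/-- Concentration of the energy of a random projection. -/
theorem measure_le_abs_energy_sub_le [IsProbabilityMeasure P] (hX : iIndepFun X P)
    (hs : ∀ p, HasSubgaussianMGF (X p) 1 P) (h0 : ∀ p, ∫ ω, X p ω ∂P = 0)
    (h1 : ∀ p, ∫ ω, X p ω ^ 2 ∂P = 1) (x : κ → ℝ) (hx : ∑ j, x j ^ 2 ≤ 1) {t : ℝ}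
    (ht0 : 0 ≤ t) (ht : t ≤ 64) :
    P {ω | (Fintype.card ι : ℝ) * t ≤ |∑ i : ι, ((∑ j, x j * X (i, j) ω) ^ 2 - ∑ j, x j ^ 2)|}
      ≤ ENNReal.ofReal (2 * Real.exp (-(Fintype.card ι * t ^ 2 / 1024))) := by
  set q : Ω → ℝ := fun ω => ∑ i : ι, ((∑ j, x j * X (i, j) ω) ^ 2 - ∑ j, x j ^ 2) with hq
  set n : ℝ := (Fintype.card ι : ℝ) with hn
  have hqm : AEMeasurable q P := by
    have := fun p => (hs p).aemeasurable
    fun_prop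
  -- Chernoff's method: `|l| = t/512` minimises `256·l² - |l|·t`, with value `-t²/1024`. The
  -- condition `|l| ≤ 1/8` is where `t ≤ 64` enters.
  have tail : ∀ l : ℝ, |l| = t / 512 →
      P {ω | n * t * (t / 512) ≤ l * q ω} ≤ ENNReal.ofReal (Real.exp (-(n * t ^ 2 / 1024))) := by
    intro l hl
    have hl2 : l ^ 2 = (t / 512) ^ 2 := by rw [← sq_abs, hl]
    have hexp := lintegral_exp_energy_le hX hs h0 h1 x hx (l := l) (by rw [hl]; linarith)
    have hmk := mul_meas_ge_le_lintegral₀ (μ := P)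
      (f := fun ω => ENNReal.ofReal (Real.exp (l * q ω)))
      (Real.measurable_exp.comp_aemeasurable (hqm.const_mul l)).ennreal_ofReal
      (ENNReal.ofReal (Real.exp (n * t * (t / 512))))
    have hset : {ω | ENNReal.ofReal (Real.exp (n * t * (t / 512)))
        ≤ ENNReal.ofReal (Real.exp (l * q ω))} = {ω | n * t * (t / 512) ≤ l * q ω} := by
      ext ω
      simp only [Set.mem_ofPred_eq]
      rw [ENNReal.ofReal_le_ofReal_iff (Real.exp_pos _).le, Real.exp_le_exp]
    rw [hset] at hmk
    have hpos : ENNReal.ofReal (Real.exp (n * t * (t / 512))) ≠ 0 := by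
      simpa using Real.exp_pos _
    rw [← ENNReal.mul_le_mul_iff_right hpos ENNReal.ofReal_ne_top,
      ← ENNReal.ofReal_mul (Real.exp_pos _).le, ← Real.exp_add]
    refine hmk.trans (hexp.trans_eq ?_)
    rw [hl2]
    congr 2
    ring
  have ht' : 0 ≤ t / 512 := by positivity
  have hsub : {ω | n * t ≤ |q ω|} ⊆ {ω | n * t * (t / 512) ≤ (t / 512) * q ω}
      ∪ {ω | n * t * (t / 512) ≤ -(t / 512) * q ω} := by
    intro ω hω
    simp only [Set.mem_ofPred_eq, Set.mem_union] at hω ⊢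
    rcases le_abs.1 hω with h | h
    · left; nlinarith
    · right; nlinarith
  refine (measure_mono hsub).trans ((measure_union_le _ _).trans
    ((add_le_add (tail _ (abs_of_nonneg ht')) (tail _ (by rw [abs_neg, abs_of_nonneg ht']))).trans_eq
      ?_))
  rw [← ENNReal.ofReal_add (Real.exp_pos _).le (Real.exp_pos _).le]
  congr 1
  ring

end Rows

/-! ### Failure probability of the restricted isometry property -/

theorem integrable_rademacher (f : ℝ → ℝ) : Integrable f CongoVariant.Z.entryLaw := by
  have h : ∀ a : ℝ, Integrable f ((2⁻¹ : ENNReal) • Measure.dirac a) := fun a =>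
    (integrable_dirac (by simp)).smul_measure (by simp)
  exact (h 1).add_measure (h (-1))

theorem integral_rademacher (f : ℝ → ℝ) :
    ∫ x, f x ∂CongoVariant.Z.entryLaw = (f 1 + f (-1)) / 2 := by
  have h : ∀ a : ℝ, Integrable f ((2⁻¹ : ENNReal) • Measure.dirac a) := fun a =>
    (integrable_dirac (by simp)).smul_measure (by simp)
  rw [CongoVariant.entryLaw, integral_add_measure (h 1) (h (-1)), integral_smul_measure,
    integral_smul_measure, integral_dirac, integral_dirac]
  simp
  ring

theorem CongoVariant.hasSubgaussianMGF_id (c : CongoVariant) :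
    HasSubgaussianMGF id 1 c.entryLaw := by
  cases c with
  | Z =>
    refine ⟨fun t => integrable_rademacher _, fun t => ?_⟩
    rw [mgf, integral_rademacher]
    have := Real.cosh_le_exp_half_sq t
    rw [Real.cosh_eq] at this
    simpa using this
  | E =>
    refine ⟨fun t => integrable_exp_mul_gaussianReal t, fun t => ?_⟩
    rw [CongoVariant.entryLaw, mgf_id_gaussianReal]
    simp

theorem CongoVariant.integral_id (c : CongoVariant) : ∫ x, x ∂c.entryLaw = 0 := by
  cases c with
  | Z => rw [integral_rademacher]; norm_num
  | E => exact integral_id_gaussianReal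

theorem CongoVariant.integral_sq (c : CongoVariant) : ∫ x, x ^ 2 ∂c.entryLaw = 1 := by
  cases c with
  | Z => rw [integral_rademacher]; norm_num
  | E =>
    have h := variance_id_gaussianReal (μ := 0) (v := 1)
    rw [variance_of_integral_eq_zero aemeasurable_id integral_id_gaussianReal] at h
    change ∫ x, x ^ 2 ∂(gaussianReal 0 1) = 1
    simpa using h

section Failure

variable {Ω : Type*} [MeasurableSpace Ω] {P : Measure Ω}

theorem CongoVariant.hasSubgaussianMGF_of_hasLaw {c : CongoVariant} {Y : Ω → ℝ}
    (h : HasLaw Y c.entryLaw P) : HasSubgaussianMGF Y 1 P := by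
  rw [← HasSubgaussianMGF.id_map_iff h.aemeasurable, h.map_eq]
  exact c.hasSubgaussianMGF_id

theorem norm_sq_smul_toEuclideanLin_sub {m d : ℕ} (hm : 0 < m) (A : Matrix (Fin m) (Fin d) ℝ)
    (w : Vec d) : ‖((1 / Real.sqrt m) • A).toEuclideanLin w‖ ^ 2 - ‖w‖ ^ 2
      = 1 / m * ∑ i, ((∑ j, w j * A i j) ^ 2 - ∑ j, w j ^ 2) := by
  have hm' : (0 : ℝ) < m := Nat.cast_pos.2 hm
  have e : ∀ i, (A.toEuclideanLin w) i = ∑ j, w j * A i j := fun i => by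
    simp [Matrix.toEuclideanLin, Matrix.mulVec, dotProduct, mul_comm]
  rw [map_smul, LinearMap.smul_apply, norm_smul, mul_pow, Real.norm_eq_abs, sq_abs, div_pow,
    Real.sq_sqrt hm'.le, one_pow, EuclideanSpace.real_norm_sq_eq, EuclideanSpace.real_norm_sq_eq w,
    Finset.sum_sub_distrib, Finset.sum_const, Finset.card_univ, Fintype.card_fin, nsmul_eq_mul]
  simp_rw [e]
  field_simp

/-- A union bound over the test vectors, each at deviation `t = 1/100`, half the isometry constant;
the rate is `t²/1024 = 1/10240000`. -/
theorem measure_not_hasRIP_le [IsProbabilityMeasure P] {c : CongoVariant} {m d k : ℕ}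
    (hm : 0 < m) (hk : k ≤ d) {A : Ω → Matrix (Fin m) (Fin d) ℝ}
    (hlaw : ∀ i j, HasLaw (fun ω => A ω i j) c.entryLaw P)
    (hind : iIndepFun (fun (p : Fin m × Fin d) ω => A ω p.1 p.2) P) :
    P {ω | ¬ HasRIP k (1 / 50) ((1 / Real.sqrt m) • A ω)}
      ≤ ENNReal.ofReal (d.choose k * 9 ^ k * (2 * Real.exp (-(m / 10240000)))) := by
  obtain ⟨N, hN1, hNc, hN⟩ := exists_rip_test_vectors hk
  have hsub : {ω | ¬ HasRIP k (1 / 50) ((1 / Real.sqrt m) • A ω)}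
      ⊆ ⋃ w ∈ N, {ω | (Fintype.card (Fin m) : ℝ) * (1 / 100)
        ≤ |∑ i, ((∑ j, w j * A ω i j) ^ 2 - ∑ j, w j ^ 2)|} := by
    intro ω hω
    by_contra hno
    simp only [Set.mem_iUnion, Set.mem_ofPred_eq, not_exists, not_le] at hno
    refine hω (hN m _ _ fun w hw => ?_)
    have h := hno w hw
    have hm' : (0 : ℝ) < m := Nat.cast_pos.2 hm
    rw [Fintype.card_fin] at h
    rw [norm_sq_smul_toEuclideanLin_sub hm, abs_mul, abs_of_nonneg (by positivity),
      one_div_mul_eq_div, div_le_iff₀ hm']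
    linarith
  have hone : ∀ w ∈ N, P {ω | (Fintype.card (Fin m) : ℝ) * (1 / 100)
        ≤ |∑ i, ((∑ j, w j * A ω i j) ^ 2 - ∑ j, w j ^ 2)|}
      ≤ ENNReal.ofReal (2 * Real.exp (-(m / 10240000))) := by
    intro w hw
    have hw1 : ∑ j, w j ^ 2 ≤ 1 := by
      rw [← EuclideanSpace.real_norm_sq_eq]
      exact pow_le_one₀ (norm_nonneg _) (hN1 w hw)
    refine (measure_le_abs_energy_sub_le (X := fun (p : Fin m × Fin d) ω => A ω p.1 p.2) hind
      (fun p => CongoVariant.hasSubgaussianMGF_of_hasLaw (hlaw p.1 p.2))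
      (fun p => ((hlaw p.1 p.2).integral_eq).trans c.integral_id)
      (fun p => ((hlaw p.1 p.2).integral_comp (f := fun x => x ^ 2) (by fun_prop)).trans
        c.integral_sq) w hw1 (by norm_num) (by norm_num)).trans_eq ?_
    rw [Fintype.card_fin]
    congr 4
    ring
  refine (measure_mono hsub).trans ((measure_biUnion_finset_le N _).trans
    ((Finset.sum_le_card_nsmul N _ _ hone).trans ?_))
  rw [nsmul_eq_mul, ← ENNReal.ofReal_natCast, ← ENNReal.ofReal_mul (Nat.cast_nonneg _)]
  refine ENNReal.ofReal_le_ofReal (mul_le_mul_of_nonneg_right ?_ (by positivity))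
  exact_mod_cast hNc

/-- This is `d.choose k ≤ (e·d/k)^k`, from `d^k/k!` and `k^k/k! ≤ e^k`. -/
theorem choose_le_exp {d k : ℕ} (hk : 0 < k) (hd : 0 < d) :
    (d.choose k : ℝ) ≤ Real.exp (k * Real.log (Real.exp 1 * d / k)) := by
  have hk' : (0 : ℝ) < k := Nat.cast_pos.2 hk
  have hd' : (0 : ℝ) < d := Nat.cast_pos.2 hd
  have hpos : 0 < Real.exp 1 * d / k := by positivity
  have h1 : (d.choose k : ℝ) ≤ (d : ℝ) ^ k / k.factorial := Nat.choose_le_pow_div k d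
  have h2 := Real.pow_div_factorial_le_exp (x := k) hk'.le k
  have hf : (0 : ℝ) < k.factorial := Nat.cast_pos.2 k.factorial_pos
  refine h1.trans ?_
  rw [Real.exp_nat_mul, Real.exp_log hpos, div_pow, mul_pow, ← Real.exp_nat_mul, mul_one,
    div_le_div_iff₀ hf (by positivity)]
  rw [div_le_iff₀ hf] at h2
  calc (d : ℝ) ^ k * (k : ℝ) ^ k ≤ (d : ℝ) ^ k * (Real.exp k * k.factorial) := by gcongr
    _ = Real.exp k * (d : ℝ) ^ k * k.factorial := by ring

/-- Since `51200000 = 5 · 10240000`, five units of `k·log (e·d/k)` are available: one pays for the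
binomial coefficient, three for `9^k`, one for the factor 2. The share of `log (2T)` more than
yields the square. -/
theorem failure_bound_le {d k T m : ℕ} (hk : 0 < k) (hkd : k ≤ d) (hT : 0 < T)
    (hm : 51200000 * (k * Real.log (Real.exp 1 * d / k) + Real.log (2 * T)) ≤ m) :
    (d.choose k * 9 ^ k * (2 * Real.exp (-(m / 10240000))) : ℝ) ≤ 1 / (2 * T) ^ 2 := by
  have hk' : (1 : ℝ) ≤ k := Nat.one_le_cast.2 hk
  have hkd' : (k : ℝ) ≤ d := Nat.cast_le.2 hkd
  have hT' : (1 : ℝ) ≤ T := Nat.one_le_cast.2 hT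
  have hk0 : (0 : ℝ) < k := by linarith
  have hd0 : (0 : ℝ) < d := by linarith
  set a := Real.log (Real.exp 1 * d / k) with ha
  have ha1 : 1 ≤ a := by
    rw [ha, Real.le_log_iff_exp_le (by positivity), le_div_iff₀ (by positivity)]
    exact mul_le_mul_of_nonneg_left hkd' (Real.exp_pos 1).le
  have hka : (k : ℝ) ≤ k * a := le_mul_of_one_le_right (by positivity) ha1
  have h9 : (9 : ℝ) ^ k ≤ Real.exp (3 * (k * a)) := by
    have h3 : (9 : ℝ) ≤ Real.exp 3 := by
      have e : Real.exp 3 = Real.exp 1 ^ 3 := by rw [← Real.exp_nat_mul]; norm_num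
      rw [e]
      have := Real.exp_one_gt_d9
      calc (9 : ℝ) ≤ 2.7 ^ 3 := by norm_num
        _ ≤ _ := pow_le_pow_left₀ (by norm_num) (by linarith) 3
    calc (9 : ℝ) ^ k ≤ Real.exp 3 ^ k := pow_le_pow_left₀ (by norm_num) h3 k
      _ = Real.exp (k * 3) := (Real.exp_nat_mul _ _).symm
      _ ≤ _ := Real.exp_le_exp.2 (by linarith)
  have h2 : (2 : ℝ) ≤ Real.exp (k * a) := by
    have := Real.add_one_le_exp (k * a)
    linarith
  have hexp : Real.exp (-(m / 10240000))
      ≤ Real.exp (-(5 * (k * a)) - 2 * Real.log (2 * T)) := by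
    have : 0 ≤ Real.log (2 * T) := Real.log_nonneg (by linarith)
    exact Real.exp_le_exp.2 (by linarith)
  calc (d.choose k * 9 ^ k * (2 * Real.exp (-(m / 10240000))) : ℝ)
      ≤ Real.exp (k * a) * Real.exp (3 * (k * a)) * (Real.exp (k * a)
        * Real.exp (-(5 * (k * a)) - 2 * Real.log (2 * T))) := by
        gcongr
        exact choose_le_exp hk (hk.trans_le hkd)
    _ = Real.exp (-(2 * Real.log (2 * T))) := by
        rw [← Real.exp_add, ← Real.exp_add, ← Real.exp_add]; congr 1; ring
    _ = 1 / (2 * T) ^ 2 := by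
        have e : Real.exp (2 * Real.log (2 * T)) = (2 * T : ℝ) ^ 2 := by
          have := Real.exp_nat_mul (Real.log (2 * T)) 2
          rw [Real.exp_log (by positivity)] at this
          exact_mod_cast this
        rw [Real.exp_neg, e, one_div]

end Failure

/-! ### Expected regret -/

theorem outerExpectation_le_of_forall_le {Ω : Type*} [MeasurableSpace Ω] (P : Measure Ω)
    [IsProbabilityMeasure P] {X : Ω → ENNReal} {b : ENNReal} (h : ∀ ω, X ω ≤ b) :
    outerExpectation P X ≤ b :=
  iInf_le_of_le (fun _ => b) (iInf_le_of_le measurable_const (iInf_le_of_le h (by simp)))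

/-- The bad set need not be measurable. Its measurable hull has the same measure and supplies a
measurable majorant. -/
theorem outerExpectation_le_add_mul {Ω : Type*} [MeasurableSpace Ω] (P : Measure Ω)
    [IsProbabilityMeasure P] {X : Ω → ENNReal} {a b : ENNReal} {S : Set Ω} (hb : ∀ ω, X ω ≤ b)
    (ha : ∀ ω, ω ∉ S → X ω ≤ a) : outerExpectation P X ≤ a + b * P S := by
  have hS := measurableSet_toMeasurable P S
  refine iInf_le_of_le (fun ω => a + (toMeasurable P S).indicator (fun _ => b) ω)
    (iInf_le_of_le (measurable_const.add (measurable_const.indicator hS)) (iInf_le_of_le ?_ ?_))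
  · intro ω
    by_cases hω : ω ∈ toMeasurable P S
    · simpa [hω] using (hb ω).trans le_add_self
    · simpa [hω] using ha ω fun h => hω (subset_toMeasurable P S h)
  · rw [lintegral_add_left measurable_const, lintegral_indicator_const hS, measure_toMeasurable]
    simp

theorem half_sq_dist_le_halfSqDiam {d : ℕ} {K : Set (Vec d)} {R : ℝ} (hR : ∀ x ∈ K, ‖x‖ ≤ R)
    {x y : Vec d} (hx : x ∈ K) (hy : y ∈ K) : ‖x - y‖ ^ 2 / 2 ≤ halfSqDiam K := by
  refine le_ciSup (f := fun p : K × K => ‖(p.1 : Vec d) - (p.2 : Vec d)‖ ^ 2 / 2)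
    ⟨(2 * R) ^ 2 / 2, ?_⟩ (⟨x, hx⟩, ⟨y, hy⟩)
  rintro _ ⟨⟨u, v⟩, rfl⟩
  have h1 : ‖(u : Vec d) - v‖ ≤ 2 * R := (norm_sub_le _ _).trans (by linarith [hR u u.2, hR v v.2])
  have := pow_le_pow_left₀ (norm_nonneg _) h1 2
  simp only
  linarith

/-- With `r = √T` and `Lf·r ≤ 1`, the Lipschitz bound is at most `2Rr`, within the contribution
`4Rr` of the term `4R/Lf`. -/
theorem lipschitz_regret_le {D R Lf q r : ℝ} (hD : 0 ≤ D) (hR : 0 ≤ R) (hLf : 0 < Lf)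
    (hq : 1 ≤ q) (hr : 0 ≤ r) (h : R = 0 ∨ Lf * r ≤ 1) :
    2 * R * Lf * r ^ 2 ≤ 3 * q * ((D + R / 2 + 4 * R / Lf) * Lf * r) := by
  have e : (D + R / 2 + 4 * R / Lf) * Lf * r = (D * Lf + R / 2 * Lf + 4 * R) * r := by
    field_simp
  rw [e]
  have h1 : 4 * R * r ≤ (D * Lf + R / 2 * Lf + 4 * R) * r :=
    mul_le_mul_of_nonneg_right (by nlinarith [mul_nonneg hD hLf.le, mul_nonneg hR hLf.le]) hr
  have h0 : 0 ≤ R * r := mul_nonneg hR hr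
  have h2 : 2 * R * Lf * r ^ 2 ≤ 2 * (R * r) := by
    rcases h with rfl | h
    · simp
    · nlinarith
  have h3 : (D * Lf + R / 2 * Lf + 4 * R) * r
      ≤ q * ((D * Lf + R / 2 * Lf + 4 * R) * r) := le_mul_of_one_le_left (by linarith) hq
  linarith

/-- With `r = √T`, the second-order term of descent is at most `Lf·r + 4`, which contains no `R`;
the factor `q` with `q·R ≥ 1` lets the terms proportional to `R` absorb it. -/
theorem descent_regret_le {D R Lf q r β : ℝ} (hD : 0 ≤ D) (hR : 0 ≤ R) (hLf : 0 < Lf)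
    (hq : 1 ≤ q) (hqR : 1 ≤ q * R) (hr : 1 ≤ r) (h : 1 ≤ Lf * r) (hβ0 : 0 ≤ β)
    (hβ : β * r ^ 2 ≤ 2) :
    D / (1 / (Lf * r)) + 1 / (Lf * r) / 2 * (r ^ 2 * (Lf + β) ^ 2) + r ^ 2 * (β * (2 * R))
      ≤ 2 * q * ((D + R / 2 + 4 * R / Lf) * Lf * r) := by
  have hr0 : 0 < r := by linarith
  have e1 : D / (1 / (Lf * r)) = D * Lf * r := by field_simp
  have e2 : 2 * q * ((D + R / 2 + 4 * R / Lf) * Lf * r)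
      = 2 * (q * (D * Lf * r)) + q * R * (Lf * r) + 8 * (q * R) * r := by
    field_simp; ring
  have e3 : 1 / (Lf * r) / 2 * (r ^ 2 * (Lf + β) ^ 2) ≤ Lf * r + 4 := by
    rw [div_div, one_div_mul_eq_div, div_le_iff₀ (by positivity)]
    have h1 : (r * (Lf + β)) ^ 2 ≤ 2 * (Lf * r) ^ 2 + 2 * (β * r) ^ 2 := by
      nlinarith [sq_nonneg (Lf * r - β * r)]
    have h2 : β * r ≤ 2 := by nlinarith
    have h3 : (β * r) ^ 2 ≤ 4 := by nlinarith [mul_nonneg hβ0 hr0.le]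
    nlinarith
  have hDr : 0 ≤ D * Lf * r := by positivity
  have e4 : D * Lf * r ≤ q * (D * Lf * r) := le_mul_of_one_le_left hDr hq
  have e5 : Lf * r ≤ q * R * (Lf * r) := le_mul_of_one_le_left (by linarith) hqR
  have e6 : r ≤ q * R * r := le_mul_of_one_le_left hr0.le hqR
  have e7 : R ≤ q * R * r := (le_mul_of_one_le_left hR hq).trans
    (le_mul_of_one_le_right (by linarith) hr)
  have e8 : r ^ 2 * (β * (2 * R)) ≤ 4 * R := by nlinarith
  rw [e1, e2]
  linarith

/-- The prescribed `δ` gives `L·δ = 2/(7.2·T)`, so the required accuracy is free of `L` and the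
count depends on `Lf` and `T` only. -/
theorem exists_iteration_count : ∃ N : ℝ → ℕ → ℕ, ∀ Lf T, 0 < T → ∀ n, N Lf T ≤ n →
    (1 / 10 : ℝ) ^ n * Lf ≤ 0.1 * (2 / (7.2 * T)) := by
  have h : ∀ (Lf : ℝ) (T : ℕ), ∃ N : ℕ, 0 < T → ∀ n, N ≤ n →
      (1 / 10 : ℝ) ^ n * Lf ≤ 0.1 * (2 / (7.2 * T)) := by
    intro Lf T
    have hlim : Filter.Tendsto (fun n : ℕ => (1 / 10 : ℝ) ^ n * Lf) Filter.atTop (nhds 0) := by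
      simpa using (tendsto_pow_atTop_nhds_zero_of_lt_one (by norm_num : (0 : ℝ) ≤ 1 / 10)
        (by norm_num)).mul_const Lf
    rcases Nat.eq_zero_or_pos T with rfl | hT
    · exact ⟨0, fun h => absurd h (lt_irrefl 0)⟩
    · have hT' : (0 : ℝ) < T := Nat.cast_pos.2 hT
      obtain ⟨N, hN⟩ := Filter.eventually_atTop.1
        (hlim.eventually_le_const (by positivity : (0 : ℝ) < 0.1 * (2 / (7.2 * T))))
      exact ⟨N, fun _ => hN⟩
  choose N hN using h
  exact ⟨N, hN⟩

theorem mainTheorem2 (variant : CongoVariant) :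
    ∃ C κ : ℝ, ∃ N : ℝ → ℕ → ℕ, 0 < C ∧ 0 < κ ∧
      ∀ (d s T : ℕ) (_ : 0 < s) (_ : 4 * s ≤ d) (_ : 0 < T)
        (R Lf L : ℝ) (_ : 0 < Lf) (_ : 0 < L)
        (K : Set (Vec d)) (_ : IsCompact K) (_ : Convex ℝ K) (_ : ∀ x ∈ K, ‖x‖ ≤ R)
        (x₁ : Vec d) (_ : x₁ ∈ K)
        (m : ℕ) (_ : m = ⌈C * (4 * s * Real.log (Real.exp 1 * d / (4 * s))
          + Real.log (2 * T))⌉₊)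
        (η δ : ℝ) (_ : η = 1 / (Lf * Real.sqrt T)) (_ : δ = 2 / (7.2 * L * T))
        (n : ℕ) (_ : N Lf T ≤ n)
        (recover : Matrix (Fin m) (Fin d) ℝ → Vec m → Vec d)
        (_ : ∀ M y, IsCoSaMP M y s n (recover M y)),
        (∀ (M : Matrix (Fin m) (Fin d) ℝ) (x : Vec d) (f : Vec d → ℝ),
          (congoEstimate recover Lf L δ M x).numQueries f = m + 1) ∧
        ∀ {Ω : Type*} [MeasurableSpace Ω] (P : Measure Ω) [IsProbabilityMeasure P]
          (A : ℕ → Ω → Matrix (Fin m) (Fin d) ℝ)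
          (_ : ∀ t < T, ∀ i j, HasLaw (fun ω => A t ω i j) variant.entryLaw P)
          (_ : iIndepFun (fun (p : Fin T × Fin m × Fin d) (ω : Ω) => A p.1 ω p.2.1 p.2.2) P),
          outerExpectation P
              (fun ω => adversarialRegret recover s Lf L η δ K x₁ T fun t => A t ω)
            ≤ ENNReal.ofReal (κ * max 1 (1 / R)
                * ((halfSqDiam K + R / 2 + 4 * R / Lf) * Lf * Real.sqrt T)) := by
  obtain ⟨N, hN⟩ := exists_iteration_count
  -- The factor 3 is 2 from the good event plus 1 from the failure event.
  refine ⟨51200000, 3, N, by norm_num, by norm_num, ?_⟩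
  intro d s T hs hd hT R Lf L hLf hL K hK hconv hR x₁ hx₁ m hm η δ hη hδ n hn recover hrec
  refine ⟨numQueries_congoEstimate recover Lf L δ, ?_⟩
  intro Ω _ P _ A hlaw hind
  have hT' : (1 : ℝ) ≤ T := Nat.one_le_cast.2 hT
  set D := halfSqDiam K with hDdef
  set q := max 1 (1 / R) with hqdef
  set r := Real.sqrt T with hrdef
  have hr2 : r ^ 2 = T := Real.sq_sqrt (by linarith)
  have hr1 : 1 ≤ r := Real.one_le_sqrt.2 hT'
  have hR0 : 0 ≤ R := (norm_nonneg _).trans (hR x₁ hx₁)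
  have hq1 : 1 ≤ q := le_max_left _ _
  have hdiam : ∀ x ∈ K, ∀ y ∈ K, ‖x - y‖ ^ 2 / 2 ≤ D := fun x hx y hy =>
    half_sq_dist_le_halfSqDiam hR hx hy
  have hD0 : 0 ≤ D := by simpa using hdiam x₁ hx₁ x₁ hx₁
  have htriv : ∀ ω, adversarialRegret recover s Lf L η δ K x₁ T (fun t => A t ω)
      ≤ ENNReal.ofReal (2 * R * Lf * T) := fun ω =>
    adversarialRegret_le_of_lipschitz hK hR hx₁ hLf.le
  -- For `R = 0` the convention `1 / 0 = 0` gives `q = 1`, and the Lipschitz bound is 0. In the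
  -- other case of the disjunction that bound already suffices.
  by_cases hcase : R = 0 ∨ Lf * r ≤ 1
  · refine outerExpectation_le_of_forall_le P fun ω => (htriv ω).trans
      (ENNReal.ofReal_le_ofReal ?_)
    rw [← hr2]
    exact lipschitz_regret_le hD0 hR0 hLf hq1 (by linarith) hcase
  push Not at hcase
  have hRpos : 0 < R := lt_of_le_of_ne hR0 (Ne.symm hcase.1)
  have hqR : 1 ≤ q * R :=
    (one_div_mul_cancel hcase.1).ge.trans (mul_le_mul_of_nonneg_right (le_max_right _ _) hR0)
  have hδ0 : 0 < δ := by rw [hδ]; positivity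
  have hη0 : 0 < η := by rw [hη]; positivity
  have hLδ : L * δ = 2 / (7.2 * T) := by rw [hδ]; field_simp
  have hceil : 51200000 * (4 * s * Real.log (Real.exp 1 * d / (4 * s)) + Real.log (2 * T))
      ≤ (m : ℝ) := by rw [hm]; exact Nat.le_ceil _
  have h4s : ((4 * s : ℕ) : ℝ) = 4 * s := by push_cast; ring
  have hm0 : 0 < m := by
    have h1 : 0 ≤ Real.log (Real.exp 1 * d / (4 * s)) := by
      have hs' : (0 : ℝ) < 4 * s := by positivity
      have hd' : (4 * s : ℝ) ≤ d := by exact_mod_cast hd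
      refine Real.log_nonneg ((one_le_div hs').2 (hd'.trans ?_))
      exact le_mul_of_one_le_left (by positivity) (Real.one_le_exp zero_le_one)
    have h2 : 0 < Real.log (2 * T) := Real.log_pos (by linarith)
    have h3 : (0 : ℝ) < m := lt_of_lt_of_le (by positivity) hceil
    exact_mod_cast h3
  set B : Set Ω := ⋃ t ∈ Finset.range T,
    {ω | ¬ HasRIP (4 * s) (1 / 50) ((1 / Real.sqrt m) • A t ω)} with hB
  have hPB : P B ≤ ENNReal.ofReal (T * (1 / (2 * T) ^ 2)) := by
    refine (measure_biUnion_finset_le _ _).trans ((Finset.sum_le_card_nsmul _ _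
      (ENNReal.ofReal (1 / (2 * T) ^ 2)) fun t ht => ?_).trans_eq ?_)
    · have ht' := Finset.mem_range.1 ht
      refine (measure_not_hasRIP_le hm0 hd (hlaw t ht') (hind.precomp
        (g := fun p : Fin m × Fin d => ((⟨t, ht'⟩ : Fin T), p))
        (Prod.mk_right_injective _))).trans (ENNReal.ofReal_le_ofReal ?_)
      exact failure_bound_le (by omega) hd hT (by rw [h4s]; exact hceil)
    · rw [Finset.card_range, nsmul_eq_mul, ENNReal.ofReal_mul (Nat.cast_nonneg _),
        ENNReal.ofReal_natCast]
  have hgood : ∀ ω, ω ∉ B → adversarialRegret recover s Lf L η δ K x₁ T (fun t => A t ω)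
      ≤ ENNReal.ofReal (2 * q * ((D + R / 2 + 4 * R / Lf) * Lf * r)) := by
    intro ω hω
    have hrip : ∀ t < T, HasRIP (4 * s) (1 / 50) ((1 / Real.sqrt m) • A t ω) := by
      intro t ht
      by_contra hno
      exact hω (Set.mem_biUnion (Finset.mem_coe.2 (Finset.mem_range.2 ht)) hno)
    refine (adversarialRegret_le_of_hasRIP hK hconv hR hdiam hx₁ hd hrec hLf.le hL.le hη0 hδ0
      (by rw [hLδ]; exact hN Lf T hT n hn) hrip).trans (ENNReal.ofReal_le_ofReal ?_)
    have hβ : 7.21 / 2 * L * δ = 7.21 / 2 * (2 / (7.2 * T)) := by rw [← hLδ]; ring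
    rw [hη, hβ, ← hr2]
    refine descent_regret_le hD0 hR0 hLf hq1 hqR hr1 hcase.2.le (by positivity) ?_
    -- The left-hand side equals `7.21/7.2`.
    field_simp
    norm_num
  refine (outerExpectation_le_add_mul P htriv hgood).trans ?_
  have hQ : 0 ≤ 2 * q * ((D + R / 2 + 4 * R / Lf) * Lf * r) := by positivity
  refine (add_le_add le_rfl (mul_le_mul le_rfl hPB zero_le zero_le)).trans ?_
  rw [← ENNReal.ofReal_mul (by positivity), ← ENNReal.ofReal_add hQ (by positivity)]
  refine ENNReal.ofReal_le_ofReal ?_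
  -- Lipschitz bound times failure probability: the factors of `T` cancel exactly, which is why each
  -- round is allowed to fail with probability `1/(2T)²`.
  have e1 : 2 * R * Lf * T * (T * (1 / (2 * T) ^ 2)) = R * Lf / 2 := by field_simp
  have e2 : R * Lf / 2 ≤ (D + R / 2 + 4 * R / Lf) * Lf * r := by
    refine le_trans ?_ (le_mul_of_one_le_right (by positivity) hr1)
    have h4 : 0 ≤ 4 * R / Lf := by positivity
    nlinarith [mul_nonneg hD0 hLf.le, mul_nonneg h4 hLf.le]
  have e3 : (D + R / 2 + 4 * R / Lf) * Lf * r ≤ q * ((D + R / 2 + 4 * R / Lf) * Lf * r) :=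
    le_mul_of_one_le_left (by positivity) hq1
  rw [e1]
  linarith
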